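/- **Setting.** A *metric graph* $G=(V,E)$ is a connected multigraph (multiple edges and self-loops allowed) with finitely many vertices and edges. Each edge $e$ is identified with an interval $I_e$, which is either $[0,\ell_e]$ with $0<\ell_e<\infty$ or a half-line $[0,+\infty)$ ($\ell_e=+\infty$). A half-line is attached to the rest of the graph at its endpoint $0$, and its other end is a vertex at infinity, of degree one. A function $u$ on $G$ is a family $(u_e)_{e\in E}$ of functions $u_e:I_e\to\mathbb R$, and $u\in H^1(G)$ if $u_e\in H^1(I_e)$ for every $e$ and $u$ is continuous on $G$ (each $u_e$ is continuous, and branches meeting at a vertex not at infinity take the same value there). Fix $2<p<6$. Put $$E(u,G)=\frac12\sum_{e}\int_{I_e}|u_e'|^2\,dx-\frac1p\sum_e\int_{I_e}|u_e|^p\,dx,\qquad H^1_\mu(G)=\Bigl\{u\in H^1(G):\ \sum_e\int_{I_e}|u_e|^2\,dx=\mu\Bigr\},$$ and define $E(\cdot,I)$ and $H^1_\mu(I)$ in the same way for $I=\mathbb R$ and $I=\mathbb R^+=[0,+\infty)$. For $\mu>0$, the soliton $\phi_\mu$ of mass $\mu$ is a positive even function that minimizes $E(\cdot,\mathbb R)$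 over $H^1_\mu(\mathbb R)$. **Theorem.** Let $2<p<6$ and $\mu>0$, and let $G$ be a (connected) metric graph that contains at least one half-line. Then the solitons $\phi_\mu$ and $\phi_{2\mu}$ exist, $\inf_{u\in H^1_\mu(G)}E(u,G)$ is finite, and, for all such $\phi_\mu$ and $\phi_{2\mu}$, $$\inf_{u\in H^1_\mu(G)}E(u,G)\ \le\ \min_{\phi\in H^1_\mu(\mathbb R)}E(\phi,\mathbb R)=E(\phi_\mu,\mathbb R)$$ and $$\inf_{u\in H^1_\mu(G)}E(u,G)\ \ge\ \min_{\phi\in H^1_\mu(\mathbb R^+)}E(\phi,\mathbb R^+)=\frac12\,E(\phi_{2\mu},\mathbb R),$$ both minima being attained. -/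

import Mathlib

open MeasureTheory
open scoped ContDiff

noncomputable section

namespace NLS

/-! ### The space `H¹(I)` and the NLS energy on a real interval `I` -/

/-- `v` is a weak derivative of `u` on the interval `I`: for every test function `η`, smooth and
compactly supported in the interior of `I`, one has `∫_I u η' = - ∫_I v η`. -/
def IsWeakDeriv (I : Set ℝ) (u v : ℝ → ℝ) : Prop :=
  ∀ η : ℝ → ℝ, ContDiff ℝ ∞ η → HasCompactSupport η → tsupport η ⊆ interior I →
    (∫ x in I, u x * deriv η x) = -(∫ x in I, v x * η x)

/-- `u` has a weak derivative in `L²(I)`. -/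
def HasL2WeakDeriv (I : Set ℝ) (u : ℝ → ℝ) : Prop :=
  ∃ v : ℝ → ℝ, MemLp v 2 (volume.restrict I) ∧ IsWeakDeriv I u v

open Classical in
/-- The weak derivative `u'` in `L²(I)`, unique up to null sets when it exists
(and `0` by convention otherwise). -/
def weakDeriv (I : Set ℝ) (u : ℝ → ℝ) : ℝ → ℝ :=
  if h : HasL2WeakDeriv I u then h.choose else 0

/-- The Sobolev space `H¹(I)`, every element being identified with its continuous representative
on the closed interval `I`. Functions are total on `ℝ`, but only their values on `I` matter. -/
def H1 (I : Set ℝ) : Set (ℝ → ℝ) :=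
  {u | ContinuousOn u I ∧ MemLp u 2 (volume.restrict I) ∧ HasL2WeakDeriv I u}

/-- `H¹_μ(I)`: the functions in `H¹(I)` of mass `‖u‖²_{L²(I)} = μ`. -/
def H1Mass (I : Set ℝ) (μ : ℝ) : Set (ℝ → ℝ) :=
  {u | u ∈ H1 I ∧ (∫ x in I, |u x| ^ 2) = μ}

/-- `E(u, I) = ½ ∫_I |u'|² - (1/p) ∫_I |u|^p`. -/
def energy (p : ℝ) (I : Set ℝ) (u : ℝ → ℝ) : ℝ :=
  1 / 2 * (∫ x in I, |weakDeriv I u x| ^ 2) - 1 / p * (∫ x in I, |u x| ^ p)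

/-- `φ` is the soliton `φ_μ`: a positive and even minimizer of `E(·, ℝ)` over `H¹_μ(ℝ)`. -/
structure IsSoliton (p μ : ℝ) (φ : ℝ → ℝ) : Prop where
  mem : φ ∈ H1Mass Set.univ μ
  isMinOn : IsMinOn (energy p Set.univ) (H1Mass Set.univ μ) φ
  pos : ∀ x, 0 < φ x
  even : Function.Even φ

end NLS

/-! ### Metric graphs -/

/-- A metric multigraph with vertex set `V` and edge set `E`; multiple edges and self-loops are
allowed. Every edge `e` has a length in `(0, ∞]` and a coordinate `x_e`, for which `src e` is the
vertex at `x_e = 0` and `tgt e` the vertex at `x_e = ℓ_e`. If `ℓ_e = ∞` then `e` is a half-line and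
`tgt e` is a vertex at infinity. Vertices at infinity have degree one. -/
structure MetricGraph (V E : Type*) where
  len : E → ENNReal
  len_pos : ∀ e, 0 < len e
  src : E → V
  tgt : E → V
  degree_infinity : ∀ e, len e = ⊤ → (∀ f, src f ≠ tgt e) ∧ ∀ f, tgt f = tgt e → f = e

namespace MetricGraph

variable {V E : Type*} (G : MetricGraph V E)

/-- The edge `e` is a half-line. -/
def IsHalfLine (e : E) : Prop := G.len e = ⊤

/-- Connectedness of the underlying graph `(V, E)`; it depends only on which pairs of distinct
vertices are joined by some edge. -/
def IsConnected : Prop :=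
  (SimpleGraph.fromRel fun v w : V => ∃ e, G.src e = v ∧ G.tgt e = w).Connected

open Classical in
/-- The interval `I_e`: `[0, ∞)` for a half-line, `[0, ℓ_e]` otherwise. -/
def interval (e : E) : Set ℝ :=
  if G.len e = ⊤ then Set.Ici 0 else Set.Icc 0 (G.len e).toReal

/-- The endpoint of the edge `e` with coordinate `x_e = x` is the (finite) vertex `v`. -/
def EndAt (v : V) (e : E) (x : ℝ) : Prop :=
  (x = 0 ∧ G.src e = v) ∨ (G.len e ≠ ⊤ ∧ x = (G.len e).toReal ∧ G.tgt e = v)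

/-- A function on the graph is a family `u = (u_e)`. It is continuous if every `u_e` is continuous
on `I_e` and the branches that meet at a vertex take the same value there. -/
def ContinuousOnGraph (u : E → ℝ → ℝ) : Prop :=
  (∀ e, ContinuousOn (u e) (G.interval e)) ∧
    ∀ v e f x y, G.EndAt v e x → G.EndAt v f y → u e x = u f y

/-- The Sobolev space `H¹(G)`. -/
def H1 : Set (E → ℝ → ℝ) :=
  {u | G.ContinuousOnGraph u ∧ ∀ e, u e ∈ NLS.H1 (G.interval e)}

variable [Fintype E]

/-- `H¹_μ(G)`: the functions in `H¹(G)` of mass `‖u‖²_{L²(G)} = μ`. -/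
def H1Mass (μ : ℝ) : Set (E → ℝ → ℝ) :=
  {u | u ∈ G.H1 ∧ (∑ e, ∫ x in G.interval e, |u e x| ^ 2) = μ}

/-- `E(u, G) = ½ ∑_e ∫_{I_e} |u_e'|² - (1/p) ∑_e ∫_{I_e} |u_e|^p`. -/
def energy (p : ℝ) (u : E → ℝ → ℝ) : ℝ :=
  1 / 2 * (∑ e, ∫ x in G.interval e, |NLS.weakDeriv (G.interval e) (u e) x| ^ 2)
    - 1 / p * (∑ e, ∫ x in G.interval e, |u e x| ^ p)

/-- The infimum of `E(·, G)` over `H¹_μ(G)`. -/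
def infEnergy (p μ : ℝ) : ℝ := sInf (G.energy p '' G.H1Mass μ)

end MetricGraph

end

open Set Filter Topology

/-! ### Weak derivatives in L²: fundamental theorem of calculus and uniqueness -/

namespace NLS

/-! The lower bounds come from a calibration, without rearrangement or compactness. Let N be the
supremum of |u|, let h(s) = √(2/p (N^(p-2) s² - |s|^p)) (`slope`), and let F be its primitive
vanishing at 0 (`calib`). Young's inequality h(u)|u'| ≤ ½|u'|² + ½h(u)² integrates to ∫ h(u)|u'| ≤
E(u) + N^(p-2) μ / p (`integral_slope_mul_le`). The left side bounds the variation of F(u). A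
half-line forces u to come close to 0, so by connectedness the images of the edges under |F(u)|
cover (0, F(N)) up to its endpoint, and the variation is at least F(N) (`exists_calib_le_energy`).
On the line F(u) has to rise and fall, which gives 2F(N) (`exists_calib_le_energy_univ`).

Equality in Young's inequality is the first-order equation |u'| = h(u), solved by an explicit power
of 1/cosh (`bump`). Along this solution F(N) is computed as N^((p+2)/2) times a constant
(`calib_self`). Minimizing F(N) - N^(p-2) μ / p over N is then Bernoulli's inequality, the Pohozaev
identity placing the minimum at the height of the half-soliton of mass μ (`halfEnergy_le`). Hence
the explicit functions are minimizers on the line and on the half-line, and the half-line value also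
bounds the energy on every graph with a half-line.

For the upper bound, the soliton of mass μ is moved to infinity along a half-line, cut off at the
origin, rescaled to mass μ and extended by zero; its energy tends to that on the line
(`exists_tendsto_energy`). -/

lemma deriv_smoothTransition_eq_zero_of_nonpos {x : ℝ} (hx : x ≤ 0) :
    deriv Real.smoothTransition x = 0 := by
  apply IsLocalMin.deriv_eq_zero
  filter_upwards with y
  rw [Real.smoothTransition.zero_of_nonpos hx]
  exact Real.smoothTransition.nonneg y

lemma deriv_smoothTransition_eq_zero_of_one_le {x : ℝ} (hx : 1 ≤ x) :
    deriv Real.smoothTransition x = 0 := by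
  apply IsLocalMax.deriv_eq_zero
  filter_upwards with y
  rw [Real.smoothTransition.one_of_one_le hx]
  exact Real.smoothTransition.le_one y

lemma continuous_deriv_smoothTransition : Continuous (deriv Real.smoothTransition) :=
  (Real.smoothTransition.contDiff (n := 1)).continuous_deriv le_rfl

lemma hasDerivAt_smoothTransition (x : ℝ) :
    HasDerivAt Real.smoothTransition (deriv Real.smoothTransition x) x :=
  ((Real.smoothTransition.contDiff (n := 1)).differentiable one_ne_zero x).hasDerivAt

lemma hasCompactSupport_deriv_smoothTransition :
    HasCompactSupport (deriv Real.smoothTransition) := by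
  refine HasCompactSupport.intro (isCompact_Icc (a := (0 : ℝ)) (b := 1)) fun x hx => ?_
  rcases lt_or_ge x 0 with h | h
  · exact deriv_smoothTransition_eq_zero_of_nonpos h.le
  · exact deriv_smoothTransition_eq_zero_of_one_le (by by_contra! h'; exact hx ⟨h, h'.le⟩)

lemma integrable_deriv_smoothTransition : Integrable (deriv Real.smoothTransition) :=
  continuous_deriv_smoothTransition.integrable_of_hasCompactSupport
    hasCompactSupport_deriv_smoothTransition

lemma integral_deriv_smoothTransition : ∫ x, deriv Real.smoothTransition x = 1 := by
  rw [← setIntegral_eq_integral_of_forall_compl_eq_zero (s := Ioc (0 : ℝ) 1),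
    ← intervalIntegral.integral_of_le zero_le_one,
    intervalIntegral.integral_eq_sub_of_hasDerivAt
      (fun x _ => hasDerivAt_smoothTransition x)
      (continuous_deriv_smoothTransition.intervalIntegrable _ _)]
  · simp
  · intro x hx
    rcases le_or_gt x 0 with h | h
    · exact deriv_smoothTransition_eq_zero_of_nonpos h
    · exact deriv_smoothTransition_eq_zero_of_one_le (by by_contra! h'; exact hx ⟨h, h'.le⟩)

/-- The derivatives of steepening smooth steps at `c` form an approximate identity at `c`. -/
lemma tendsto_integral_mul_step {f : ℝ → ℝ} (hf : Continuous f) {C : ℝ} (hC : ∀ x, |f x| ≤ C)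
    (c d : ℝ) :
    Tendsto (fun n : ℕ => ∫ x, f x *
      (((n : ℝ) + 1) * deriv Real.smoothTransition (((n : ℝ) + 1) * (x - c) + d))) atTop
      (𝓝 (f c)) := by
  have hsub : ∀ n : ℕ, ∫ x, f x *
      (((n : ℝ) + 1) * deriv Real.smoothTransition (((n : ℝ) + 1) * (x - c) + d)) =
      ∫ t, f (c + ((n : ℝ) + 1)⁻¹ * (t - d)) * deriv Real.smoothTransition t := by
    intro n
    have hn : (0 : ℝ) < (n : ℝ) + 1 := by positivity
    set g : ℝ → ℝ := fun t =>
      f (c + ((n : ℝ) + 1)⁻¹ * (t - d)) * deriv Real.smoothTransition t with hg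
    have h1 : ∫ x, g (((n : ℝ) + 1) * x) = |(((n : ℝ) + 1))⁻¹| • ∫ t, g t :=
      Measure.integral_comp_mul_left g _
    have h2 : ∫ x, g (((n : ℝ) + 1) * (x + (d / ((n : ℝ) + 1) - c))) =
        ∫ x, g (((n : ℝ) + 1) * x) :=
      integral_add_right_eq_self (fun x => g (((n : ℝ) + 1) * x)) _
    rw [h1, abs_of_pos (by positivity), smul_eq_mul] at h2
    have h3 : ∫ t, g t = ((n : ℝ) + 1) * ∫ x, g (((n : ℝ) + 1) * (x + (d / ((n : ℝ) + 1) - c))) := by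
      rw [h2]; field_simp
    rw [h3, ← integral_const_mul]
    congr 1
    ext x
    have e1 : ((n : ℝ) + 1) * (x + (d / ((n : ℝ) + 1) - c)) = ((n : ℝ) + 1) * (x - c) + d := by
      field_simp; ring
    have e2 : c + ((n : ℝ) + 1)⁻¹ * (((n : ℝ) + 1) * (x - c) + d - d) = x := by
      field_simp; ring
    simp only [hg, e1, e2]
    ring
  simp_rw [hsub]
  have hlim : f c = ∫ t, f c * deriv Real.smoothTransition t := by
    rw [integral_const_mul, integral_deriv_smoothTransition, mul_one]
  rw [hlim]
  refine tendsto_integral_of_dominated_convergence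
    (fun t => C * |deriv Real.smoothTransition t|) (fun n => ?_)
    (integrable_deriv_smoothTransition.abs.const_mul _) (fun n => ?_) ?_
  · exact (Continuous.mul (by fun_prop) continuous_deriv_smoothTransition).aestronglyMeasurable
  · filter_upwards with t
    rw [Real.norm_eq_abs, abs_mul]
    gcongr
    exact hC _
  · filter_upwards with t
    refine Tendsto.mul_const _ ((hf.tendsto c).comp ?_)
    have h0 : Tendsto (fun n : ℕ => ((n : ℝ) + 1)⁻¹) atTop (𝓝 0) := by
      simpa using tendsto_one_div_add_atTop_nhds_zero_nat (𝕜 := ℝ)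
    simpa using (h0.mul_const (t - d)).const_add c

/-- The test functions are smooth steps up at a minus smooth steps up at b. They converge to the
indicator of (a, b), and their derivatives to δ_a - δ_b. -/
lemma IsWeakDeriv.sub_eq_integral_of_subset_interior {I : Set ℝ} {u v : ℝ → ℝ}
    (hIm : MeasurableSet I) (hu : ContinuousOn u I) (hv : LocallyIntegrableOn v I) (h : IsWeakDeriv I u v) {a b : ℝ}
    (hab : a < b) (hI : Icc a b ⊆ interior I) :
    u b - u a = ∫ x in a..b, v x := by
  have hII : Icc a b ⊆ I := hI.trans interior_subset
  have huc : ContinuousOn u (Icc a b) := hu.mono hII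
  -- A bounded continuous extension of u to all of ℝ, as the approximate identity requires.
  set f : ℝ → ℝ := IccExtend hab.le ((Icc a b).domRestrict u) with hf
  have hfc : Continuous f := (continuousOn_iff_continuous_domRestrict.1 huc).Icc_extend'
  have hfu : ∀ x ∈ Icc a b, f x = u x := fun x hx => by
    rw [hf, IccExtend_of_mem _ _ hx]; rfl
  obtain ⟨C, hC⟩ := isCompact_Icc.exists_bound_of_continuousOn huc
  have hfC : ∀ x, |f x| ≤ C := fun x => hC _ (projIcc a b hab.le x).2
  -- The offset 0 makes s rise just to the right of a and the offset 1 makes r rise just to the left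
  -- of b, so that s - r is eventually supported in [a, b].
  set s : ℕ → ℝ → ℝ := fun n x => Real.smoothTransition (((n : ℝ) + 1) * (x - a) + 0) with hs
  set r : ℕ → ℝ → ℝ := fun n x => Real.smoothTransition (((n : ℝ) + 1) * (x - b) + 1) with hr
  set s' : ℕ → ℝ → ℝ := fun n x =>
    ((n : ℝ) + 1) * deriv Real.smoothTransition (((n : ℝ) + 1) * (x - a) + 0) with hs'
  set r' : ℕ → ℝ → ℝ := fun n x =>
    ((n : ℝ) + 1) * deriv Real.smoothTransition (((n : ℝ) + 1) * (x - b) + 1) with hr'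
  have hd : ∀ c d k x : ℝ, HasDerivAt (fun x => Real.smoothTransition (k * (x - c) + d))
      (k * deriv Real.smoothTransition (k * (x - c) + d)) x := by
    intro c d k x
    have h1 : HasDerivAt (fun x => k * (x - c) + d) k x := by
      simpa using ((((hasDerivAt_id x).sub_const c).const_mul k).add_const d)
    have h2 := (hasDerivAt_smoothTransition _).comp x h1
    rw [mul_comm] at h2
    exact h2
  have hcs : ∀ c d : ℝ, ∀ n : ℕ, HasCompactSupport (fun x =>
      ((n : ℝ) + 1) * deriv Real.smoothTransition (((n : ℝ) + 1) * (x - c) + d)) := by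
    intro c d n
    have hn : (0 : ℝ) < (n : ℝ) + 1 := by positivity
    refine HasCompactSupport.intro
      (isCompact_Icc (a := c - d / ((n : ℝ) + 1)) (b := c + (1 - d) / ((n : ℝ) + 1))) fun x hx => ?_
    rw [mem_Icc, not_and_or, not_le, not_le] at hx
    rcases hx with hx | hx
    · rw [deriv_smoothTransition_eq_zero_of_nonpos, mul_zero]
      have : x - c < -d / ((n : ℝ) + 1) := by rw [neg_div]; linarith
      rw [lt_div_iff₀ hn] at this
      linarith
    · rw [deriv_smoothTransition_eq_zero_of_one_le, mul_zero]
      have : (1 - d) / ((n : ℝ) + 1) < x - c := by linarith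
      rw [div_lt_iff₀ hn] at this
      linarith
  have hη : ∀ᶠ n : ℕ in atTop, ∀ x, x ∉ Icc a b → s n x - r n x = 0 ∧ s' n x - r' n x = 0 := by
    filter_upwards [(tendsto_natCast_atTop_atTop (R := ℝ)).eventually_ge_atTop (1 / (b - a))]
      with n hn x hx
    have hn0 : (0 : ℝ) < (n : ℝ) + 1 := by positivity
    have hn1 : 1 ≤ ((n : ℝ) + 1) * (b - a) := by
      rw [div_le_iff₀ (by linarith)] at hn
      nlinarith
    rw [mem_Icc, not_and_or, not_le, not_le] at hx
    rcases hx with hx | hx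
    · have h1 : ((n : ℝ) + 1) * (x - a) + 0 ≤ 0 := by nlinarith
      have h2 : ((n : ℝ) + 1) * (x - b) + 1 ≤ 0 := by nlinarith
      simp only [hs, hr, hs', hr', Real.smoothTransition.zero_of_nonpos h1,
        Real.smoothTransition.zero_of_nonpos h2, deriv_smoothTransition_eq_zero_of_nonpos h1,
        deriv_smoothTransition_eq_zero_of_nonpos h2]
      simp
    · have h1 : 1 ≤ ((n : ℝ) + 1) * (x - a) + 0 := by nlinarith
      have h2 : 1 ≤ ((n : ℝ) + 1) * (x - b) + 1 := by nlinarith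
      simp only [hs, hr, hs', hr', Real.smoothTransition.one_of_one_le h1,
        Real.smoothTransition.one_of_one_le h2, deriv_smoothTransition_eq_zero_of_one_le h1,
        deriv_smoothTransition_eq_zero_of_one_le h2]
      simp
  have hsmooth : ∀ c d k : ℝ, ContDiff ℝ ∞ (fun x => Real.smoothTransition (k * (x - c) + d)) :=
    fun c d k => Real.smoothTransition.contDiff.comp (by fun_prop)
  have key : ∀ᶠ n : ℕ in atTop, (∫ x, f x * s' n x) - (∫ x, f x * r' n x) =
      - ∫ x in a..b, v x * (s n x - r n x) := by
    filter_upwards [hη] with n hn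
    have hder : ∀ x, deriv (fun x => s n x - r n x) x = s' n x - r' n x := fun x =>
      ((hd a 0 _ x).sub (hd b 1 _ x)).deriv
    have hsupp : tsupport (fun x => s n x - r n x) ⊆ Icc a b :=
      closure_minimal (fun x hx => by
        by_contra hx'; exact hx (hn x hx').1) isClosed_Icc
    have h1 := h (fun x => s n x - r n x) ((hsmooth a 0 _).sub (hsmooth b 1 _))
      (HasCompactSupport.of_support_subset_isCompact isCompact_Icc
        (subset_closure.trans hsupp)) (hsupp.trans hI)
    simp_rw [hder] at h1
    have hint : ∀ c d : ℝ, Integrable (fun x => f x *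
        (((n : ℝ) + 1) * deriv Real.smoothTransition (((n : ℝ) + 1) * (x - c) + d))) := by
      intro c d
      refine (hfc.mul (continuous_const.mul
        (continuous_deriv_smoothTransition.comp (by fun_prop)))).integrable_of_hasCompactSupport ?_
      exact (hcs c d n).mul_left
    rw [← integral_sub (hint a 0) (hint b 1)]
    have e0 : ∀ x ∉ Icc a b, f x * s' n x - f x * r' n x = 0 := fun x hx => by
      rw [← mul_sub, (hn x hx).2, mul_zero]
    have e1 : ∫ x in I, u x * (s' n x - r' n x) = ∫ x, (f x * s' n x - f x * r' n x) := by
      rw [setIntegral_eq_of_subset_of_forall_sdiff_eq_zero hIm hII fun x hx => by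
        rw [(hn x hx.2).2, mul_zero],
        ← setIntegral_eq_integral_of_forall_compl_eq_zero (s := Icc a b) e0]
      refine setIntegral_congr_fun measurableSet_Icc fun x hx => ?_
      simp only [hfu x hx, mul_sub]
    have e2 : ∫ x in I, v x * (s n x - r n x) = ∫ x in a..b, v x * (s n x - r n x) := by
      rw [setIntegral_eq_of_subset_of_forall_sdiff_eq_zero hIm hII fun x hx => by
        rw [(hn x hx.2).1, mul_zero], integral_Icc_eq_integral_Ioc,
        intervalIntegral.integral_of_le hab.le]
    rw [← e1, ← e2]
    exact h1
  have hvint : IntervalIntegrable v volume a b := by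
    rw [intervalIntegrable_iff_integrableOn_Icc_of_le hab.le]
    exact hv.integrableOn_compact_subset hII isCompact_Icc
  have hlimv : Tendsto (fun n : ℕ => ∫ x in a..b, v x * (s n x - r n x)) atTop
      (𝓝 (∫ x in a..b, v x)) := by
    refine intervalIntegral.tendsto_integral_filter_of_dominated_convergence (fun x => |v x|)
      (Eventually.of_forall fun n => ?_) (Eventually.of_forall fun n => ?_) hvint.abs ?_
    · refine hvint.def'.aestronglyMeasurable.mul (Continuous.aestronglyMeasurable ?_)
      exact ((hsmooth a 0 _).sub (hsmooth b 1 _)).continuous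
    · filter_upwards with x _
      rw [norm_mul, Real.norm_eq_abs]
      refine mul_le_of_le_one_right (abs_nonneg _) ?_
      rw [Real.norm_eq_abs, abs_le]
      have h1 := Real.smoothTransition.nonneg (((n : ℝ) + 1) * (x - a) + 0)
      have h2 := Real.smoothTransition.nonneg (((n : ℝ) + 1) * (x - b) + 1)
      have h3 := Real.smoothTransition.le_one (((n : ℝ) + 1) * (x - a) + 0)
      have h4 := Real.smoothTransition.le_one (((n : ℝ) + 1) * (x - b) + 1)
      constructor <;> simp only [hs, hr] <;> linarith
    · have hb : ∀ᵐ x : ℝ, x ≠ b := by simp [ae_iff, measure_singleton]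
      filter_upwards [hb] with x hxb hx
      rw [uIoc_of_le hab.le] at hx
      have hx2 : x < b := lt_of_le_of_ne hx.2 hxb
      refine tendsto_const_nhds.congr' ?_
      filter_upwards [(tendsto_natCast_atTop_atTop (R := ℝ)).eventually_ge_atTop (1 / (x - a)),
        (tendsto_natCast_atTop_atTop (R := ℝ)).eventually_ge_atTop (1 / (b - x))] with n h1 h2
      rw [div_le_iff₀ (by linarith [hx.1])] at h1
      rw [div_le_iff₀ (by linarith [hx.1])] at h2
      simp only [hs, hr]
      rw [Real.smoothTransition.one_of_one_le (by nlinarith [hx.1]),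
        Real.smoothTransition.zero_of_nonpos (by nlinarith [hx.1])]
      simp
  have hL := (tendsto_integral_mul_step hfc hfC a 0).sub (tendsto_integral_mul_step hfc hfC b 1)
  have := tendsto_nhds_unique (hL.congr' key) hlimv.neg
  rw [hfu a (left_mem_Icc.2 hab.le), hfu b (right_mem_Icc.2 hab.le)] at this
  linarith

lemma MemLp.locallyIntegrableOn {I : Set ℝ} {v : ℝ → ℝ}
    (hv : MemLp v 2 (volume.restrict I)) : LocallyIntegrableOn v I :=
  locallyIntegrableOn_of_locallyIntegrable_restrict (hv.locallyIntegrable (by norm_num))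

/-- The fundamental theorem of calculus for weak derivatives in `L²`. -/
lemma IsWeakDeriv.sub_eq_integral {I : Set ℝ} {u v : ℝ → ℝ}
    (hIm : I.OrdConnected) (hu : ContinuousOn u I) (hv : MemLp v 2 (volume.restrict I))
    (h : IsWeakDeriv I u v) {a b : ℝ} (hab : a ≤ b) (ha : a ∈ I) (hb : b ∈ I) :
    u b - u a = ∫ x in a..b, v x := by
  rcases hab.eq_or_lt with rfl | hab
  · simp
  have hI : Icc a b ⊆ I := hIm.out ha hb
  have hvI : IntegrableOn v (Icc a b) :=
    (MemLp.locallyIntegrableOn hv).integrableOn_compact_subset hI isCompact_Icc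
  have hF : ContinuousOn (fun x => u x - ∫ t in a..x, v t) (Icc a b) := by
    refine (hu.mono hI).sub ?_
    have := intervalIntegral.continuousOn_primitive_interval (μ := volume)
      (f := v) (a := a) (b := b) (by rwa [uIcc_of_le hab.le])
    rwa [uIcc_of_le hab.le] at this
  have hIoo : Ioo a b ⊆ interior I :=
    interior_maximal (Ioo_subset_Icc_self.trans hI) isOpen_Ioo
  have hii : ∀ x ∈ Icc a b, ∀ y ∈ Icc a b, IntervalIntegrable v volume x y := fun x hx y hy =>
    (hvI.mono_set (uIcc_subset_Icc hx hy)).intervalIntegrable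
  have hconst : ∀ x ∈ Ioo a b, ∀ y ∈ Ioo a b, x < y →
      u x - (∫ t in a..x, v t) = u y - ∫ t in a..y, v t := by
    intro x hx y hy hxy
    have h1 := h.sub_eq_integral_of_subset_interior hIm.measurableSet hu
      (MemLp.locallyIntegrableOn hv) hxy ((Icc_subset_Ioo hx.1 hy.2).trans hIoo)
    rw [← intervalIntegral.integral_interval_sub_left
        (hii a (left_mem_Icc.2 hab.le) y (Ioo_subset_Icc_self hy))
        (hii a (left_mem_Icc.2 hab.le) x (Ioo_subset_Icc_self hx))] at h1
    linarith
  set c := (a + b) / 2 with hc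
  have hcm : c ∈ Ioo a b := ⟨by linarith, by linarith⟩
  -- Test functions see only the interior of I, while a and b may be its endpoints; continuity
  -- carries the constancy from (a, b) to [a, b].
  have heq : EqOn (fun x => u x - ∫ t in a..x, v t) (fun _ => u c - ∫ t in a..c, v t)
      (Icc a b) := by
    refine EqOn.of_subset_closure (s := Ioo a b) (fun x hx => ?_) hF continuousOn_const
      Ioo_subset_Icc_self (closure_Ioo hab.ne).ge
    rcases lt_trichotomy x c with hxc | rfl | hxc
    · exact hconst x hx c hcm hxc
    · rfl
    · exact (hconst c hcm x hx hxc).symm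
  have h1 := heq (left_mem_Icc.2 hab.le)
  have h2 := heq (right_mem_Icc.2 hab.le)
  simp only [intervalIntegral.integral_same] at h1 h2
  linarith

/-- Weak derivatives are unique up to null sets. -/
lemma IsWeakDeriv.ae_eq {I : Set ℝ} {u v w : ℝ → ℝ} (hI : I.OrdConnected)
    (hv : MemLp v 2 (volume.restrict I)) (hw : MemLp w 2 (volume.restrict I))
    (h : IsWeakDeriv I u v) (h' : IsWeakDeriv I u w) : v =ᵐ[volume.restrict I] w := by
  -- An interval is convex, so its frontier is null and agreement on the interior suffices.
  have hfr : ∀ᵐ x : ℝ, x ∉ frontier I :=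
    measure_eq_zero_iff_ae_notMem.1 (hI.convex.addHaar_frontier volume)
  have h1 : ∀ᵐ x : ℝ, x ∈ interior I → v x - w x = 0 := by
    refine isOpen_interior.ae_eq_zero_of_integral_contDiff_smul_eq_zero
      (((MemLp.locallyIntegrableOn hv).sub (MemLp.locallyIntegrableOn hw)).mono_set
        interior_subset) fun η hη hηc hηs => ?_
    have hηi : ∀ z : ℝ → ℝ, MemLp z 2 (volume.restrict I) →
        Integrable (fun x => z x * η x) (volume.restrict I) := fun z hz =>
      hz.integrable_mul (q := 2) (hη.continuous.memLp_of_hasCompactSupport hηc)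
    have h2 := h η hη hηc hηs
    rw [h' η hη hηc hηs, neg_inj] at h2
    rw [← setIntegral_eq_integral_of_forall_compl_eq_zero (s := I)]
    · rw [← sub_eq_zero.2 h2.symm, ← integral_sub (hηi v hv) (hηi w hw)]
      congr 1
      ext x
      simp only [smul_eq_mul]
      ring
    · intro x hx
      rw [image_eq_zero_of_notMem_tsupport fun hx' => hx (interior_subset (hηs hx')), zero_smul]
  rw [EventuallyEq, ae_restrict_iff' hI.measurableSet]
  filter_upwards [hfr, h1] with x hx hx1 hxI
  have : x ∈ interior I := by
    by_contra hx'
    exact hx ⟨subset_closure hxI, hx'⟩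
  linarith [hx1 this]

lemma isWeakDeriv_of_hasDerivAt (I : Set ℝ) {u u' : ℝ → ℝ} (hu : ∀ x, HasDerivAt u (u' x) x)
    (hu' : Continuous u') : IsWeakDeriv I u u' := by
  intro η hη hηc hηs
  have huc : Continuous u := continuous_iff_continuousAt.2 fun x => (hu x).continuousAt
  have hηd : ∀ x, HasDerivAt η (deriv η x) x := fun x =>
    (hη.differentiable (by simp) x).hasDerivAt
  have hη'c : Continuous (deriv η) := hη.continuous_deriv (by simp)
  have hi1 : Integrable (fun x => u x * deriv η x) :=
    (huc.mul hη'c).integrable_of_hasCompactSupport hηc.deriv.mul_left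
  have hi2 : Integrable (fun x => u' x * η x) :=
    (hu'.mul hη.continuous).integrable_of_hasCompactSupport hηc.mul_left
  have h0 : ∀ x ∉ I, x ∉ tsupport η := fun x hx hx' => hx (interior_subset (hηs hx'))
  rw [setIntegral_eq_integral_of_forall_compl_eq_zero fun x hx => by
      rw [image_eq_zero_of_notMem_tsupport fun h => h0 x hx (tsupport_deriv_subset h), mul_zero],
    setIntegral_eq_integral_of_forall_compl_eq_zero fun x hx => by
      rw [image_eq_zero_of_notMem_tsupport (h0 x hx), mul_zero]]
  exact integral_mul_deriv_eq_deriv_mul_of_integrable (fun x _ => hu x) (fun x _ => hηd x) hi1 hi2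
    ((huc.mul hη.continuous).integrable_of_hasCompactSupport hηc.mul_left)

section

variable {I : Set ℝ} {u : ℝ → ℝ}

lemma memLp_weakDeriv (hu : u ∈ H1 I) : MemLp (weakDeriv I u) 2 (volume.restrict I) := by
  rw [weakDeriv, dif_pos hu.2.2]
  exact hu.2.2.choose_spec.1

lemma isWeakDeriv_weakDeriv (hu : u ∈ H1 I) : IsWeakDeriv I u (weakDeriv I u) := by
  rw [weakDeriv, dif_pos hu.2.2]
  exact hu.2.2.choose_spec.2

lemma sub_eq_integral_weakDeriv (hI : I.OrdConnected) (hu : u ∈ H1 I) {a b : ℝ} (hab : a ≤ b)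
    (ha : a ∈ I) (hb : b ∈ I) : u b - u a = ∫ x in a..b, weakDeriv I u x :=
  (isWeakDeriv_weakDeriv hu).sub_eq_integral hI hu.1 (memLp_weakDeriv hu) hab ha hb

lemma mem_H1_of_hasDerivAt {u' : ℝ → ℝ} (hu : ∀ x, HasDerivAt u (u' x) x)
    (hu' : Continuous u') (hL : MemLp u 2 (volume.restrict I))
    (hL' : MemLp u' 2 (volume.restrict I)) : u ∈ H1 I :=
  ⟨(continuous_iff_continuousAt.2 fun x => (hu x).continuousAt).continuousOn, hL, u', hL',
    isWeakDeriv_of_hasDerivAt I hu hu'⟩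

/-- `weakDeriv` is a choice; this is how the energies of explicit functions become computable. -/
lemma weakDeriv_ae_eq_of_hasDerivAt (hI : I.OrdConnected) {u' : ℝ → ℝ}
    (hu : ∀ x, HasDerivAt u (u' x) x) (hu' : Continuous u')
    (hL : MemLp u 2 (volume.restrict I)) (hL' : MemLp u' 2 (volume.restrict I)) :
    weakDeriv I u =ᵐ[volume.restrict I] u' :=
  have h := mem_H1_of_hasDerivAt hu hu' hL hL'
  IsWeakDeriv.ae_eq hI (memLp_weakDeriv h) hL' (isWeakDeriv_weakDeriv h)
    (isWeakDeriv_of_hasDerivAt I hu hu')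

end

end NLS

/-! ### Chain rule in H¹ and integrability -/

/-- f takes its values in a compact interval, on which a C¹ function is Lipschitz. -/
lemma AbsolutelyContinuousOnInterval.contDiff_comp {f Φ : ℝ → ℝ} {a b : ℝ}
    (hf : AbsolutelyContinuousOnInterval f a b) (hΦ : ContDiff ℝ 1 Φ) :
    AbsolutelyContinuousOnInterval (fun x => Φ (f x)) a b := by
  obtain ⟨C, hC⟩ := hf.exists_bound
  obtain ⟨K, hK⟩ := (hΦ.contDiffOn (s := Icc (-C) C)).exists_lipschitzOnWith (by decide)
    (convex_Icc _ _) isCompact_Icc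
  have hm : ∀ x ∈ uIcc a b, f x ∈ Icc (-C) C := fun x hx => abs_le.1 (hC x hx)
  unfold AbsolutelyContinuousOnInterval at hf ⊢
  refine squeeze_zero' (Eventually.of_forall fun t => Finset.sum_nonneg fun i _ => dist_nonneg)
    ?_ (by simpa using hf.const_mul (K : ℝ))
  rw [eventually_inf_principal]
  filter_upwards with E hE
  rw [Finset.mul_sum]
  exact Finset.sum_le_sum fun i hi =>
    hK.dist_le_mul _ (hm _ (hE.1 i hi).1) _ (hm _ (hE.1 i hi).2)

namespace NLS

variable {I : Set ℝ} {u : ℝ → ℝ}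

/-- The chain rule in integrated form. -/
lemma abs_comp_sub_comp_le (hI : I.OrdConnected) (hu : u ∈ H1 I) {Φ h : ℝ → ℝ}
    (hΦ : ∀ s, HasDerivAt Φ (h s) s) (hh : Continuous h) {a b : ℝ} (hab : a ≤ b) (ha : a ∈ I)
    (hb : b ∈ I) :
    |Φ (u b) - Φ (u a)| ≤ ∫ x in Icc a b, |h (u x)| * |weakDeriv I u x| := by
  set v := weakDeriv I u with hv
  have hIcc : Icc a b ⊆ I := hI.out ha hb
  have hvI : IntervalIntegrable v volume a b := by
    rw [intervalIntegrable_iff_integrableOn_Icc_of_le hab]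
    exact (MemLp.locallyIntegrableOn (memLp_weakDeriv hu)).integrableOn_compact_subset hIcc
      isCompact_Icc
  -- This primitive equals u on [a, b], is absolutely continuous, and has derivative v almost
  -- everywhere there.
  set f : ℝ → ℝ := fun x => u a + ∫ t in a..x, v t with hf
  have hfu : ∀ x ∈ Icc a b, f x = u x := fun x hx => by
    rw [hf]
    simp only
    rw [← sub_eq_integral_weakDeriv hI hu hx.1 ha (hIcc hx)]
    ring
  have hfac : AbsolutelyContinuousOnInterval f a b := by
    refine AbsolutelyContinuousOnInterval.add (f := fun _ => u a) ?_
      (hvI.absolutelyContinuousOnInterval_intervalIntegral left_mem_uIcc)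
    exact (contDiff_const (n := 1)).contDiffOn.absolutelyContinuousOnInterval
  have hΦ1 : ContDiff ℝ 1 Φ := by
    rw [contDiff_one_iff_deriv]
    refine ⟨fun s => (hΦ s).differentiableAt, ?_⟩
    rwa [show deriv Φ = h from funext fun s => (hΦ s).deriv]
  have h1 := (hfac.contDiff_comp hΦ1).integral_deriv_eq_sub
  rw [hfu b (right_mem_Icc.2 hab), hfu a (left_mem_Icc.2 hab)] at h1
  rw [← h1, ← Real.norm_eq_abs]
  refine (intervalIntegral.norm_integral_le_integral_norm hab).trans (le_of_eq ?_)
  rw [intervalIntegral.integral_of_le hab, ← integral_Icc_eq_integral_Ioc]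
  refine setIntegral_congr_ae measurableSet_Icc ?_
  filter_upwards [hvI.ae_hasDerivAt_integral] with x hx hxm
  have h2 : HasDerivAt f (v x) x :=
    (hx (by rwa [uIcc_of_le hab]) a left_mem_uIcc).const_add (u a)
  have h3 : HasDerivAt (fun x => Φ (f x)) (h (f x) * v x) x := (hΦ (f x)).comp x h2
  rw [h3.deriv, hfu x hxm, Real.norm_eq_abs, abs_mul]

lemma abs_comp_sub_comp_le_setIntegral (hI : I.OrdConnected) (hu : u ∈ H1 I) {Φ h : ℝ → ℝ}
    (hΦ : ∀ s, HasDerivAt Φ (h s) s) (hh : Continuous h)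
    (hint : IntegrableOn (fun x => |h (u x)| * |weakDeriv I u x|) I) {a b : ℝ} (ha : a ∈ I)
    (hb : b ∈ I) :
    |Φ (u b) - Φ (u a)| ≤ ∫ x in I, |h (u x)| * |weakDeriv I u x| := by
  wlog hab : a ≤ b generalizing a b
  · rw [abs_sub_comm]
    exact this hb ha (le_of_not_ge hab)
  refine (abs_comp_sub_comp_le hI hu hΦ hh hab ha hb).trans ?_
  exact setIntegral_mono_set hint (Eventually.of_forall fun x => by positivity)
    (hI.out ha hb).eventuallyLE

/-- The chain rule is applied to u², whose derivative 2uu' is integrable as a product of two L²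
functions. -/
lemma exists_abs_le (hI : I.OrdConnected) (hu : u ∈ H1 I) : ∃ C, ∀ x ∈ I, |u x| ≤ C := by
  rcases I.eq_empty_or_nonempty with rfl | ⟨a, ha⟩
  · exact ⟨0, by simp⟩
  have hint : IntegrableOn (fun x => |2 * u x| * |weakDeriv I u x|) I := by
    have := (hu.2.1.const_mul 2).abs.integrable_mul (q := 2) (memLp_weakDeriv hu).abs
    exact this
  refine ⟨Real.sqrt (|u a ^ 2| + ∫ x in I, |2 * u x| * |weakDeriv I u x|), fun x hx => ?_⟩
  have h1 := abs_comp_sub_comp_le_setIntegral hI hu (Φ := fun s => s ^ 2) (h := fun s => 2 * s)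
    (fun s => by simpa using hasDerivAt_pow 2 s) (by fun_prop) hint ha hx
  refine Real.abs_le_sqrt ?_
  have := abs_le.1 h1
  have := le_abs_self (u a ^ 2)
  linarith

lemma integrableOn_abs_sq (hu : MemLp u 2 (volume.restrict I)) :
    IntegrableOn (fun x => |u x| ^ 2) I := by
  simp only [sq_abs]
  exact hu.integrable_sq

lemma integrable_abs_sq (hu : u ∈ H1 I) : IntegrableOn (fun x => |u x| ^ 2) I :=
  integrableOn_abs_sq hu.2.1

lemma integrable_abs_weakDeriv_sq (hu : u ∈ H1 I) :
    IntegrableOn (fun x => |weakDeriv I u x| ^ 2) I :=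
  integrableOn_abs_sq (memLp_weakDeriv hu)

/-- Besides dominating the L^p integrand, this makes the radicand of `slope` nonnegative for |s| ≤
N. -/
lemma abs_rpow_le {N p s : ℝ} (hp : 2 < p) (hs : |s| ≤ N) :
    |s| ^ p ≤ N ^ (p - 2) * |s| ^ 2 := by
  have h0 := abs_nonneg s
  rcases h0.eq_or_lt with h | h
  · rw [← h, Real.zero_rpow (by linarith)]; simp
  calc |s| ^ p = |s| ^ (p - 2) * |s| ^ (2 : ℝ) := by rw [← Real.rpow_add h]; congr 1; ring
    _ ≤ N ^ (p - 2) * |s| ^ (2 : ℝ) := by gcongr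
    _ = _ := by norm_cast

lemma integrable_abs_rpow {p : ℝ} (hp : 2 < p) (hI : I.OrdConnected) (hu : u ∈ H1 I) :
    IntegrableOn (fun x => |u x| ^ p) I := by
  obtain ⟨C, hC⟩ := exists_abs_le hI hu
  refine Integrable.mono' ((integrable_abs_sq hu).const_mul (C ^ (p - 2))) ?_ ?_
  · exact (hu.2.1.abs.aemeasurable.pow_const p).aestronglyMeasurable
  · filter_upwards [ae_restrict_mem hI.measurableSet] with x hx
    rw [Real.norm_of_nonneg (by positivity)]
    exact abs_rpow_le hp (hC x hx)

/-- Functions in `H¹` of a half-line come close to `0` arbitrarily far out. -/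
lemma exists_abs_lt_of_Ioi_subset (hu : MemLp u 2 (volume.restrict I)) {X ε : ℝ} (hX : Ioi X ⊆ I)
    (hε : 0 < ε) : ∃ x, X < x ∧ |u x| < ε := by
  by_contra! h
  have h1 : IntegrableOn (fun x => |u x| ^ 2) (Ioi X) :=
    integrableOn_abs_sq (hu.mono_measure (Measure.restrict_mono hX le_rfl))
  have h2 : IntegrableOn (fun _ => ε ^ 2) (Ioi X) := by
    refine Integrable.mono' h1 (by fun_prop) ?_
    filter_upwards [ae_restrict_mem measurableSet_Ioi] with x hx
    rw [Real.norm_of_nonneg (by positivity)]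
    gcongr
    exact h x hx
  rw [integrableOn_const_iff] at h2
  simp [hε.ne'] at h2

lemma exists_abs_lt_of_Iio_subset (hu : MemLp u 2 (volume.restrict I)) {X ε : ℝ} (hX : Iio X ⊆ I)
    (hε : 0 < ε) : ∃ x, x < X ∧ |u x| < ε := by
  by_contra! h
  have h1 : IntegrableOn (fun x => |u x| ^ 2) (Iio X) :=
    integrableOn_abs_sq (hu.mono_measure (Measure.restrict_mono hX le_rfl))
  have h2 : IntegrableOn (fun _ => ε ^ 2) (Iio X) := by
    refine Integrable.mono' h1 (by fun_prop) ?_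
    filter_upwards [ae_restrict_mem measurableSet_Iio] with x hx
    rw [Real.norm_of_nonneg (by positivity)]
    gcongr
    exact h x hx
  rw [integrableOn_const_iff] at h2
  simp [hε.ne'] at h2

/-! ### The calibration -/

/-- The slope `√(2/p) √(N^{p-2} s² - |s|^p)` of the soliton of height `N` at height `s`. -/
noncomputable def slope (p N s : ℝ) : ℝ := Real.sqrt (2 / p * (N ^ (p - 2) * |s| ^ 2 - |s| ^ p))

/-- The primitive of the soliton slope. -/
noncomputable def calib (p N s : ℝ) : ℝ := ∫ t in (0 : ℝ)..s, slope p N t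

variable {p N : ℝ}

lemma slope_nonneg (p N s : ℝ) : 0 ≤ slope p N s := Real.sqrt_nonneg _

lemma slope_neg (p N s : ℝ) : slope p N (-s) = slope p N s := by simp [slope]

lemma continuous_slope (hp : 2 < p) : Continuous (slope p N) := by
  unfold slope
  have : Continuous fun s : ℝ => |s| ^ p :=
    continuous_abs.rpow_const fun _ => Or.inr (by linarith)
  fun_prop

lemma hasDerivAt_calib (hp : 2 < p) (s : ℝ) : HasDerivAt (calib p N) (slope p N s) s :=
  intervalIntegral.integral_hasDerivAt_right ((continuous_slope hp).intervalIntegrable _ _)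
    ((continuous_slope hp).stronglyMeasurableAtFilter _ _) (continuous_slope hp).continuousAt

lemma continuous_calib (hp : 2 < p) : Continuous (calib p N) :=
  continuous_iff_continuousAt.2 fun s => (hasDerivAt_calib hp s).continuousAt

@[simp] lemma calib_zero : calib p N 0 = 0 := by simp [calib]

lemma calib_neg (s : ℝ) : calib p N (-s) = -calib p N s := by
  have := intervalIntegral.integral_comp_neg (a := 0) (b := s) (slope p N)
  simp only [slope_neg, neg_zero] at this
  rw [calib, calib, this, intervalIntegral.integral_symm]

lemma calib_monotone (hp : 2 < p) : Monotone (calib p N) :=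
  monotone_of_deriv_nonneg (fun s => (hasDerivAt_calib hp s).differentiableAt)
    fun s => (hasDerivAt_calib hp s).deriv ▸ slope_nonneg _ _ _

lemma abs_calib (hp : 2 < p) (s : ℝ) : |calib p N s| = calib p N |s| := by
  rcases le_total 0 s with h | h
  · rw [abs_of_nonneg h, abs_of_nonneg]
    simpa using calib_monotone hp h
  · rw [abs_of_nonpos h, abs_of_nonpos, calib_neg]
    simpa using calib_monotone hp h

/-- Young's inequality ab ≤ ½a² + ½b², where ½a² expands by the choice of `slope`. Equality holds
exactly when |w| is the slope, which is the soliton equation. -/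
lemma slope_mul_le (hp : 2 < p) {s : ℝ} (hs : |s| ≤ N) (w : ℝ) :
    |slope p N s| * |w| ≤
      1 / 2 * |w| ^ 2 + (1 / p * (N ^ (p - 2) * |s| ^ 2) - 1 / p * |s| ^ p) := by
  have h1 : slope p N s ^ 2 = 2 / p * (N ^ (p - 2) * |s| ^ 2 - |s| ^ p) :=
    Real.sq_sqrt (mul_nonneg (by positivity) (sub_nonneg.2 (abs_rpow_le hp hs)))
  rw [abs_of_nonneg (slope_nonneg _ _ _)]
  have h2 : 1 / 2 * slope p N s ^ 2 = 1 / p * (N ^ (p - 2) * |s| ^ 2) - 1 / p * |s| ^ p := by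
    rw [h1]; ring
  rw [← h2]
  nlinarith [sq_nonneg (slope p N s - |w|)]

lemma integrable_slope_mul (hp : 2 < p) (hI : I.OrdConnected) (hu : u ∈ H1 I)
    (hN : ∀ x ∈ I, |u x| ≤ N) :
    IntegrableOn (fun x => |slope p N (u x)| * |weakDeriv I u x|) I := by
  refine Integrable.mono' (((integrable_abs_weakDeriv_sq hu).const_mul (1 / 2)).add
    ((((integrable_abs_sq hu).const_mul (N ^ (p - 2))).const_mul (1 / p)).sub
      ((integrable_abs_rpow hp hI hu).const_mul (1 / p)))) ?_ ?_
  · exact (((continuous_slope hp).comp_aestronglyMeasurable hu.2.1.1).norm).mul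
      (memLp_weakDeriv hu).1.norm
  · filter_upwards [ae_restrict_mem hI.measurableSet] with x hx
    rw [Real.norm_of_nonneg (by positivity)]
    exact slope_mul_le hp (hN x hx) _

lemma integral_slope_mul_le (hp : 2 < p) (hI : I.OrdConnected) (hu : u ∈ H1 I)
    (hN : ∀ x ∈ I, |u x| ≤ N) :
    ∫ x in I, |slope p N (u x)| * |weakDeriv I u x| ≤
      1 / 2 * (∫ x in I, |weakDeriv I u x| ^ 2) +
        (1 / p * (N ^ (p - 2) * ∫ x in I, |u x| ^ 2) - 1 / p * ∫ x in I, |u x| ^ p) := by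
  have i1 := (integrable_abs_weakDeriv_sq hu).const_mul (1 / 2)
  have i2 := ((integrable_abs_sq hu).const_mul (N ^ (p - 2))).const_mul (1 / p)
  have i3 := (integrable_abs_rpow hp hI hu).const_mul (1 / p)
  simp only [← integral_const_mul]
  have i4 : Integrable (fun x => 1 / p * (N ^ (p - 2) * |u x| ^ 2) - 1 / p * |u x| ^ p)
      (volume.restrict I) := i2.sub i3
  rw [← integral_sub i2 i3, ← integral_add i1 i4]
  refine integral_mono_ae (integrable_slope_mul hp hI hu hN) (i1.add i4) ?_
  filter_upwards [ae_restrict_mem hI.measurableSet] with x hx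
  exact slope_mul_le hp (hN x hx) _

end NLS

/-! ### The calibration bound on graphs -/

namespace MetricGraph

variable {V E : Type*} {G : MetricGraph V E}

lemma interval_of_isHalfLine {e : E} (he : G.IsHalfLine e) : G.interval e = Ici 0 := if_pos he

lemma interval_of_ne_top {e : E} (he : G.len e ≠ ⊤) :
    G.interval e = Icc 0 (G.len e).toReal := if_neg he

lemma ordConnected_interval (e : E) : (G.interval e).OrdConnected := by
  unfold interval
  split_ifs
  · exact ordConnected_Ici
  · exact ordConnected_Icc

lemma zero_mem_interval (e : E) : (0 : ℝ) ∈ G.interval e := by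
  unfold interval
  split_ifs <;> simp

lemma EndAt.mem_interval {v : V} {e : E} {x : ℝ} (h : G.EndAt v e x) : x ∈ G.interval e := by
  rcases h with ⟨rfl, _⟩ | ⟨he, rfl, _⟩
  · exact zero_mem_interval e
  · rw [interval_of_ne_top he]
    exact right_mem_Icc.2 ENNReal.toReal_nonneg

/-- On a connected graph with a half-line along which `f` comes close to `0`, the images of the
edges under `f` cover every interval between `0` and a value of `f`. -/
lemma Ioo_subset_iUnion_image (hconn : G.IsConnected) {f : E → ℝ → ℝ}
    (hf : G.ContinuousOnGraph f) {e₀ : E}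
    (hinf : ∀ ε > 0, ∃ x ∈ G.interval e₀, f e₀ x < ε) (e₁ : E) {x₁ : ℝ}
    (hx₁ : x₁ ∈ G.interval e₁) :
    Ioo 0 (f e₁ x₁) ⊆ ⋃ e, f e '' G.interval e := by
  rintro s ⟨hs0, hs1⟩
  by_contra hs
  simp only [mem_iUnion, mem_image, not_exists, not_and] at hs
  -- Since s is never attained, the intermediate value theorem puts a whole edge below s as soon as
  -- one of its values is.
  have hlow : ∀ e, (∃ x ∈ G.interval e, f e x < s) → ∀ x ∈ G.interval e, f e x < s := by
    rintro e ⟨x, hx, hxs⟩ y hy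
    by_contra! hys
    obtain ⟨z, hz, hzs⟩ := (ordConnected_interval e).isPreconnected.intermediate_value hx hy
      (hf.1 e) ⟨hxs.le, hys⟩
    exact hs e z hz hzs
  set low : E → Prop := fun e => ∀ x ∈ G.interval e, f e x < s with hlowdef
  -- Being below s passes between edges sharing a vertex: by continuity at a finite vertex, and
  -- trivially at a vertex at infinity, which has only one edge.
  have hinc : ∀ w e g, (G.src e = w ∨ G.tgt e = w) → (G.src g = w ∨ G.tgt g = w) →
      low e → low g := by
    intro w e g he hg hle
    by_cases hfin : (∃ x, G.EndAt w e x) ∧ ∃ y, G.EndAt w g y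
    · obtain ⟨⟨x, hx⟩, y, hy⟩ := hfin
      refine hlow g ⟨y, hy.mem_interval, ?_⟩
      rw [← hf.2 w e g x y hx hy]
      exact hle x hx.mem_interval
    · have hend : ∀ a, (G.src a = w ∨ G.tgt a = w) → (¬ ∃ x, G.EndAt w a x) →
          G.len a = ⊤ ∧ G.tgt a = w := by
        intro a ha hna
        rcases ha with ha | ha
        · exact absurd ⟨0, Or.inl ⟨rfl, ha⟩⟩ hna
        · refine ⟨?_, ha⟩
          by_contra hl
          exact hna ⟨_, Or.inr ⟨hl, rfl, ha⟩⟩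
      have heg : e = g := by
        rcases not_and_or.1 hfin with h | h
        · obtain ⟨h1, h2⟩ := hend e he h
          have h3 := G.degree_infinity e h1
          rcases hg with hg | hg
          · exact absurd (hg.trans h2.symm) (h3.1 g)
          · exact (h3.2 g (hg.trans h2.symm)).symm
        · obtain ⟨h1, h2⟩ := hend g hg h
          have h3 := G.degree_infinity g h1
          rcases he with he | he
          · exact absurd (he.trans h2.symm) (h3.1 e)
          · exact h3.2 e (he.trans h2.symm)
      exact heg ▸ hle
  set Q : V → Prop := fun w => ∀ e, (G.src e = w ∨ G.tgt e = w) → low e with hQ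
  have hstep : ∀ v w, (∃ e, G.src e = v ∧ G.tgt e = w ∨ G.src e = w ∧ G.tgt e = v) →
      Q v → Q w := by
    rintro v w ⟨e, he⟩ hv g hg
    refine hinc w e g (by tauto) hg (hv e (by tauto))
  have hwalk : ∀ v w, (SimpleGraph.fromRel fun v w : V => ∃ e, G.src e = v ∧ G.tgt e = w).Walk v w →
      Q v → Q w := by
    intro v w hw
    induction hw with
    | nil => exact id
    | @cons a b c hab _ ih =>
      intro ha
      refine ih (hstep a b ?_ ha)
      rw [SimpleGraph.fromRel_adj] at hab
      rcases hab.2 with ⟨e, he⟩ | ⟨e, he⟩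
      · exact ⟨e, Or.inl he⟩
      · exact ⟨e, Or.inr he⟩
  have h0 : Q (G.src e₀) := fun g hg => hinc _ e₀ g (Or.inl rfl) hg (hlow e₀ (hinf s hs0))
  obtain ⟨w⟩ := hconn.preconnected (G.src e₀) (G.src e₁)
  exact absurd (hwalk _ _ w h0 e₁ (Or.inl rfl) x₁ hx₁) (not_lt.2 hs1.le)

/-- If the oscillation of `f` on every edge `e` is at most `T e`, then the values of `f` are at most
`∑ e, T e`. -/
lemma le_sum_of_oscillation_le [Fintype E] (hconn : G.IsConnected) {f : E → ℝ → ℝ}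
    (hf : G.ContinuousOnGraph f) {e₀ : E}
    (hinf : ∀ ε > 0, ∃ x ∈ G.interval e₀, f e₀ x < ε) {T : E → ℝ}
    (hT : ∀ e, ∀ x ∈ G.interval e, ∀ y ∈ G.interval e, |f e x - f e y| ≤ T e)
    (e₁ : E) {x₁ : ℝ} (hx₁ : x₁ ∈ G.interval e₁) : f e₁ x₁ ≤ ∑ e, T e := by
  have hT0 : ∀ e, 0 ≤ T e := fun e =>
    (abs_nonneg _).trans (hT e 0 (zero_mem_interval e) 0 (zero_mem_interval e))
  have h1 : volume (Ioo 0 (f e₁ x₁)) ≤ ∑ e, ENNReal.ofReal (T e) := by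
    refine (measure_mono (Ioo_subset_iUnion_image hconn hf hinf e₁ hx₁)).trans ?_
    refine (measure_iUnion_fintype_le _ _).trans (Finset.sum_le_sum fun e _ => ?_)
    -- The measure of a real set is at most its diameter, and the diameter of each image is the
    -- oscillation on that edge.
    refine (Real.volume_le_diam _).trans (Metric.ediam_le ?_)
    rintro _ ⟨x, hx, rfl⟩ _ ⟨y, hy, rfl⟩
    rw [edist_dist, Real.dist_eq]
    exact ENNReal.ofReal_le_ofReal (hT e x hx y hy)
  rw [Real.volume_Ioo, sub_zero, ← ENNReal.ofReal_sum_of_nonneg fun e _ => hT0 e,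
    ENNReal.ofReal_le_ofReal_iff (Finset.sum_nonneg fun e _ => hT0 e)] at h1
  exact h1

open NLS in
/-- The calibration bound on a graph; `N` is the supremum of `|u|`. -/
theorem exists_calib_le_energy [Fintype E] (hconn : G.IsConnected) {e₀ : E}
    (he₀ : G.IsHalfLine e₀) {p μ : ℝ} (hp : 2 < p) {u : E → ℝ → ℝ} (hu : u ∈ G.H1Mass μ) :
    ∃ N, 0 ≤ N ∧ calib p N N - N ^ (p - 2) / p * μ ≤ G.energy p u := by
  obtain ⟨⟨hcont, hH1⟩, hmass⟩ := hu
  choose C hC using fun e => exists_abs_le (ordConnected_interval e) (hH1 e)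
  set S : Set ℝ := {s | ∃ e, ∃ x ∈ G.interval e, |u e x| = s} with hS
  have hSne : S.Nonempty := ⟨_, e₀, 0, zero_mem_interval e₀, rfl⟩
  have hSb : BddAbove S := by
    refine ⟨∑ e, |C e|, ?_⟩
    rintro _ ⟨e, x, hx, rfl⟩
    exact ((hC e x hx).trans (le_abs_self _)).trans
      (Finset.single_le_sum (f := fun e => |C e|) (fun e _ => abs_nonneg _) (Finset.mem_univ e))
  set N := sSup S with hN
  have hle : ∀ e, ∀ x ∈ G.interval e, |u e x| ≤ N := fun e x hx => le_csSup hSb ⟨e, x, hx, rfl⟩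
  refine ⟨N, (abs_nonneg _).trans (hle e₀ 0 (zero_mem_interval e₀)), ?_⟩
  have hbound : ∑ e, ∫ x in G.interval e, |slope p N (u e x)| * |weakDeriv (G.interval e) (u e) x| ≤
      G.energy p u + N ^ (p - 2) / p * μ := by
    refine (Finset.sum_le_sum fun e _ =>
      integral_slope_mul_le hp (ordConnected_interval e) (hH1 e) (hle e)).trans (le_of_eq ?_)
    rw [energy, ← hmass]
    simp only [Finset.sum_add_distrib, Finset.sum_sub_distrib, ← Finset.mul_sum]
    ring
  -- The supremum N need not be attained, so the bound is proved at each value of |u| and passed to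
  -- the closure.
  have hcl : closure S ⊆ {s | calib p N s ≤ G.energy p u + N ^ (p - 2) / p * μ} := by
    refine closure_minimal ?_ (isClosed_le (continuous_calib hp) continuous_const)
    rintro _ ⟨e₁, x₁, hx₁, rfl⟩
    refine le_trans ?_ hbound
    rw [← abs_calib hp]
    refine le_sum_of_oscillation_le (f := fun e x => |calib p N (u e x)|) hconn
      ⟨fun e => ((continuous_calib hp).comp_continuousOn (hcont.1 e)).abs, fun v e g x y hx hy => ?_⟩
      (e₀ := e₀) (fun ε hε => ?_) (fun e x hx y hy => ?_) e₁ hx₁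
    · simp only [hcont.2 v e g x y hx hy]
    · have h0 : ∀ᶠ s in 𝓝 (0 : ℝ), |calib p N s| < ε := by
        have := (continuous_calib (N := N) hp).abs.tendsto 0
        simp only [calib_zero, abs_zero] at this
        exact this.eventually (gt_mem_nhds hε)
      obtain ⟨δ, hδ, hδ'⟩ := Metric.eventually_nhds_iff.1 h0
      have hI := interval_of_isHalfLine he₀
      obtain ⟨x, hx, hxδ⟩ := exists_abs_lt_of_Ioi_subset (X := 0) (hH1 e₀).2.1
        (by rw [hI]; exact Ioi_subset_Ici_self) hδ
      exact ⟨x, by rw [hI]; exact hx.le, hδ' (by simpa using hxδ)⟩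
    · exact (abs_abs_sub_abs_le_abs_sub _ _).trans
        (abs_comp_sub_comp_le_setIntegral (ordConnected_interval e) (hH1 e)
          (fun s => hasDerivAt_calib hp s) (continuous_slope hp)
          (integrable_slope_mul hp (ordConnected_interval e) (hH1 e) (hle e)) hy hx)
  have : calib p N N ≤ _ := hcl (csSup_mem_closure hSne hSb)
  linarith

end MetricGraph

/-! ### The calibration bound on the half-line and on the line -/

namespace NLS

/-- The half-line as a metric graph. -/
def halfLineGraph : MetricGraph Bool Unit where
  len _ := ⊤
  len_pos _ := ENNReal.zero_lt_top
  src _ := false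
  tgt _ := true
  degree_infinity _ _ := ⟨fun _ => Bool.false_ne_true, fun _ _ => rfl⟩

lemma halfLineGraph_isConnected : halfLineGraph.IsConnected := by
  have hadj : (SimpleGraph.fromRel fun v w : Bool =>
      ∃ e, halfLineGraph.src e = v ∧ halfLineGraph.tgt e = w).Adj false true := by
    rw [SimpleGraph.fromRel_adj]
    exact ⟨Bool.false_ne_true, Or.inl ⟨(), rfl, rfl⟩⟩
  refine SimpleGraph.connected_iff _ |>.2 ⟨?_, inferInstance⟩
  rintro (_ | _) (_ | _)
  · exact SimpleGraph.Reachable.refl _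
  · exact hadj.reachable
  · exact hadj.symm.reachable
  · exact SimpleGraph.Reachable.refl _

theorem exists_calib_le_energy_Ici {p μ : ℝ} (hp : 2 < p) {u : ℝ → ℝ}
    (hu : u ∈ H1Mass (Ici 0) μ) :
    ∃ N, 0 ≤ N ∧ calib p N N - N ^ (p - 2) / p * μ ≤ energy p (Ici 0) u := by
  have hI : ∀ e, halfLineGraph.interval e = Ici 0 := fun e =>
    MetricGraph.interval_of_isHalfLine rfl
  have hend : ∀ v e x, halfLineGraph.EndAt v e x → x = 0 := by
    rintro v e x (⟨h, _⟩ | ⟨h, _⟩)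
    · exact h
    · exact absurd rfl h
  have hu' : (fun _ => u) ∈ halfLineGraph.H1Mass μ := by
    refine ⟨⟨⟨fun e => ?_, fun v e f x y hx hy => ?_⟩, fun e => ?_⟩, ?_⟩
    · rw [hI]; exact hu.1.1
    · rw [hend v e x hx, hend v f y hy]
    · rw [hI]; exact hu.1
    · simpa [hI] using hu.2
  obtain ⟨N, hN, h⟩ := MetricGraph.exists_calib_le_energy (e₀ := ()) halfLineGraph_isConnected rfl
    hp hu'
  refine ⟨N, hN, h.trans (le_of_eq ?_)⟩
  simp [MetricGraph.energy, energy, hI]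

/-- The factor 2 appears because u comes close to 0 on both sides of any point, so each value of
|calib(u)| is paid for on two disjoint intervals. -/
theorem exists_calib_le_energy_univ {p μ : ℝ} (hp : 2 < p) {u : ℝ → ℝ}
    (hu : u ∈ H1Mass univ μ) :
    ∃ N, 0 ≤ N ∧ 2 * calib p N N - N ^ (p - 2) / p * μ ≤ energy p univ u := by
  obtain ⟨hH1, hmass⟩ := hu
  have hI : (univ : Set ℝ).OrdConnected := ordConnected_univ
  obtain ⟨C, hC⟩ := exists_abs_le hI hH1
  set S : Set ℝ := range fun x => |u x| with hS
  have hSne : S.Nonempty := range_nonempty _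
  have hSb : BddAbove S := ⟨C, by rintro _ ⟨x, rfl⟩; exact hC x trivial⟩
  set N := sSup S with hN
  have hle : ∀ x ∈ univ, |u x| ≤ N := fun x _ => le_csSup hSb ⟨x, rfl⟩
  refine ⟨N, (abs_nonneg _).trans (hle 0 trivial), ?_⟩
  have hint := integrable_slope_mul hp hI hH1 hle
  have hbound : ∫ x in univ, |slope p N (u x)| * |weakDeriv univ u x| ≤
      energy p univ u + N ^ (p - 2) / p * μ := by
    refine (integral_slope_mul_le hp hI hH1 hle).trans (le_of_eq ?_)
    rw [energy, ← hmass]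
    ring
  have hcl : closure S ⊆ {s | 2 * calib p N s ≤ energy p univ u + N ^ (p - 2) / p * μ} := by
    refine closure_minimal ?_ (isClosed_le (continuous_const.mul (continuous_calib hp))
      continuous_const)
    rintro _ ⟨x₀, rfl⟩
    refine le_trans (le_of_forall_pos_le_add fun ε hε => ?_) hbound
    have h0 : ∀ᶠ s in 𝓝 (0 : ℝ), |calib p N s| < ε / 2 := by
      have := (continuous_calib (N := N) hp).abs.tendsto 0
      simp only [calib_zero, abs_zero] at this
      exact this.eventually (gt_mem_nhds (by linarith))
    obtain ⟨δ, hδ, hδ'⟩ := Metric.eventually_nhds_iff.1 h0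
    obtain ⟨z, hz, hzδ⟩ := exists_abs_lt_of_Ioi_subset (X := x₀) hH1.2.1 (subset_univ _) hδ
    obtain ⟨y, hy, hyδ⟩ := exists_abs_lt_of_Iio_subset (X := x₀) hH1.2.1 (subset_univ _) hδ
    have hz1 := hδ' (y := u z) (by simpa using hzδ)
    have hy1 := hδ' (y := u y) (by simpa using hyδ)
    have h1 := abs_comp_sub_comp_le hI hH1 (fun s => hasDerivAt_calib (N := N) hp s)
      (continuous_slope hp) hy.le trivial trivial
    have h2 := abs_comp_sub_comp_le hI hH1 (fun s => hasDerivAt_calib (N := N) hp s)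
      (continuous_slope hp) hz.le trivial trivial
    rw [integral_Icc_eq_integral_Ioc] at h1 h2
    have h3 : (∫ x in Ioc y x₀, |slope p N (u x)| * |weakDeriv univ u x|) +
        (∫ x in Ioc x₀ z, |slope p N (u x)| * |weakDeriv univ u x|) ≤
        ∫ x in univ, |slope p N (u x)| * |weakDeriv univ u x| := by
      rw [← setIntegral_union (Ioc_disjoint_Ioc_of_le le_rfl) measurableSet_Ioc
        (hint.mono_set (subset_univ _)) (hint.mono_set (subset_univ _))]
      exact setIntegral_mono_set hint (Eventually.of_forall fun x => by positivity)
        (subset_univ _).eventuallyLE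
    have h4 := abs_sub_abs_le_abs_sub (calib p N (u x₀)) (calib p N (u y))
    have h5 := abs_sub_abs_le_abs_sub (calib p N (u x₀)) (calib p N (u z))
    rw [abs_sub_comm] at h2
    simp only [← abs_calib hp]
    linarith
  have : 2 * calib p N N ≤ _ := hcl (csSup_mem_closure hSne hSb)
  linarith

end NLS

namespace NLS

/-! ### The soliton profile -/

/-- The inverse length `√(2/p) (p-2)/2` of the soliton of height one. -/
noncomputable def profileRate (p : ℝ) : ℝ := Real.sqrt (2 / p) * (p - 2) / 2

/-- The soliton of height one. -/
noncomputable def profile (p x : ℝ) : ℝ := Real.cosh (profileRate p * x) ^ (-(2 / (p - 2)))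

/-- The derivative of the soliton of height one. -/
noncomputable def profileDeriv (p x : ℝ) : ℝ :=
  -(Real.sqrt (2 / p) * (Real.sinh (profileRate p * x) / Real.cosh (profileRate p * x)) * profile p x)

variable {p : ℝ}

lemma profileRate_pos (hp : 2 < p) : 0 < profileRate p := by
  have : 0 < p - 2 := by linarith
  unfold profileRate
  positivity

lemma profile_pos (p x : ℝ) : 0 < profile p x := Real.rpow_pos_of_pos (Real.cosh_pos _) _

lemma profile_neg (p x : ℝ) : profile p (-x) = profile p x := by simp [profile]

lemma profile_zero (p : ℝ) : profile p 0 = 1 := by simp [profile]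

lemma profileDeriv_zero (p : ℝ) : profileDeriv p 0 = 0 := by simp [profileDeriv]

lemma profileDeriv_neg (p x : ℝ) : profileDeriv p (-x) = -profileDeriv p x := by
  simp [profileDeriv, profile_neg, neg_div]

/-- The rate is chosen so that `profileRate p * (2 / (p - 2))` is √(2/p). -/
lemma hasDerivAt_profile (hp : 2 < p) (x : ℝ) :
    HasDerivAt (profile p) (profileDeriv p x) x := by
  have h1 : HasDerivAt (fun x => profileRate p * x) (profileRate p) x := by
    simpa using (hasDerivAt_id x).const_mul (profileRate p)
  have h2 := h1.cosh.rpow_const (p := -(2 / (p - 2))) (Or.inl (Real.cosh_pos _).ne')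
  refine HasDerivAt.congr_deriv (f := profile p) h2 ?_
  rw [Real.rpow_sub_one (Real.cosh_pos _).ne', profileDeriv, profile]
  have h3 : p - 2 ≠ 0 := by linarith
  conv_lhs => enter [1, 1, 2]; rw [profileRate]
  have := (Real.cosh_pos (profileRate p * x)).ne'
  field_simp

lemma continuous_profile (hp : 2 < p) : Continuous (profile p) :=
  continuous_iff_continuousAt.2 fun x => (hasDerivAt_profile hp x).continuousAt

lemma continuous_profileDeriv (hp : 2 < p) : Continuous (profileDeriv p) := by
  have h1 : Continuous fun x => Real.sinh (profileRate p * x) / Real.cosh (profileRate p * x) :=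
    (Real.continuous_sinh.comp (by fun_prop)).div (Real.continuous_cosh.comp (by fun_prop))
      fun x => (Real.cosh_pos _).ne'
  exact ((continuous_const.mul h1).mul (continuous_profile hp)).neg

/-- The exponent in `profile` makes its power p - 2 equal to 1/cosh², which turns the identity for
sinh² into conservation of energy. -/
lemma profile_rpow (hp : 2 < p) (x : ℝ) :
    profile p x ^ p = profile p x ^ 2 / Real.cosh (profileRate p * x) ^ 2 := by
  have h3 : p - 2 ≠ 0 := by linarith
  have hc := Real.cosh_pos (profileRate p * x)
  rw [profile, ← Real.rpow_mul hc.le, ← Real.rpow_natCast, ← Real.rpow_mul hc.le,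
    ← Real.rpow_natCast, ← Real.rpow_sub hc]
  congr 1
  field_simp
  push_cast
  ring

/-- Conservation of the mechanical energy of the profile. -/
lemma profileDeriv_sq (hp : 2 < p) (x : ℝ) :
    profileDeriv p x ^ 2 = 2 / p * (profile p x ^ 2 - profile p x ^ p) := by
  have hc := (Real.cosh_pos (profileRate p * x)).ne'
  rw [profile_rpow hp, profileDeriv, neg_sq, mul_pow, mul_pow, Real.sq_sqrt (by positivity),
    div_pow, Real.sinh_sq]
  field_simp

lemma profileDeriv_sq_le (hp : 2 < p) (x : ℝ) :
    profileDeriv p x ^ 2 ≤ 2 / p * profile p x ^ 2 := by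
  rw [profileDeriv_sq hp]
  have := Real.rpow_nonneg (profile_pos p x).le p
  gcongr
  linarith

/-- cosh y ≥ exp |y| / 2, raised to a negative power; this supplies decay and integrability. -/
lemma profile_le_exp (hp : 2 < p) {x : ℝ} :
    profile p x ≤ 2 ^ (2 / (p - 2)) * Real.exp (-Real.sqrt (2 / p) * |x|) := by
  have h3 : 0 < p - 2 := by linarith
  have h1 : Real.exp (profileRate p * |x|) / 2 ≤ Real.cosh (profileRate p * x) := by
    rw [← Real.cosh_abs, abs_mul, abs_of_pos (profileRate_pos hp), Real.cosh_eq]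
    have := Real.exp_pos (-(profileRate p * |x|))
    linarith
  refine (Real.rpow_le_rpow_of_nonpos (by positivity) h1 (by
    have : 0 < 2 / (p - 2) := by positivity
    linarith)).trans (le_of_eq ?_)
  rw [Real.div_rpow (by positivity) (by positivity), ← Real.exp_mul, Real.rpow_neg (by positivity),
    div_inv_eq_mul, mul_comm, profileRate]
  congr 2
  field_simp

lemma tendsto_profile_atTop (hp : 2 < p) : Tendsto (profile p) atTop (𝓝 0) := by
  have hb : 0 < Real.sqrt (2 / p) := by positivity
  have h1 : Tendsto (fun x : ℝ => 2 ^ (2 / (p - 2)) * Real.exp (-(Real.sqrt (2 / p) * x))) atTop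
      (𝓝 0) := by
    simpa using (Real.tendsto_exp_neg_atTop_nhds_zero.comp
      (tendsto_id.const_mul_atTop hb)).const_mul ((2 : ℝ) ^ (2 / (p - 2)))
  refine tendsto_of_tendsto_of_tendsto_of_le_of_le' tendsto_const_nhds h1
    (Eventually.of_forall fun x => (profile_pos p x).le) ?_
  filter_upwards [eventually_ge_atTop 0] with x hx
  have := profile_le_exp hp (x := x)
  rwa [abs_of_nonneg hx, neg_mul] at this

lemma integrable_exp_neg_mul_abs {b : ℝ} (hb : 0 < b) :
    Integrable fun x : ℝ => Real.exp (-b * |x|) := by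
  have h1 : Integrable ((Ioi (0 : ℝ)).indicator fun x => Real.exp (-b * x)) :=
    (exp_neg_integrableOn_Ioi 0 hb).integrable_indicator measurableSet_Ioi
  refine (h1.add h1.comp_neg).congr ?_
  have h0 : ∀ᵐ x : ℝ, x ≠ 0 := by simp [ae_iff, measure_singleton]
  filter_upwards [h0] with x hx
  rcases lt_or_gt_of_ne hx with h | h
  · simp [indicator, h, h.le, abs_of_neg h]
  · simp [indicator, h, h.le, abs_of_pos h]

lemma integrable_profile_sq (hp : 2 < p) : Integrable fun x => profile p x ^ 2 := by
  have hb : 0 < Real.sqrt (2 / p) := by positivity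
  refine Integrable.mono' ((integrable_exp_neg_mul_abs (b := Real.sqrt (2 / p) * 2)
    (by positivity)).const_mul ((2 ^ (2 / (p - 2))) ^ 2))
    ((continuous_profile hp).pow 2).aestronglyMeasurable (Eventually.of_forall fun x => ?_)
  rw [Real.norm_of_nonneg (by positivity)]
  calc profile p x ^ 2 ≤ (2 ^ (2 / (p - 2)) * Real.exp (-Real.sqrt (2 / p) * |x|)) ^ 2 := by
        have := (profile_pos p x).le
        gcongr
        exact profile_le_exp hp
    _ = _ := by
        rw [mul_pow, ← Real.exp_nat_mul]
        push_cast
        ring_nf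

lemma integrable_profileDeriv_sq (hp : 2 < p) : Integrable fun x => profileDeriv p x ^ 2 := by
  refine Integrable.mono' ((integrable_profile_sq hp).const_mul (2 / p))
    ((continuous_profileDeriv hp).pow 2).aestronglyMeasurable (Eventually.of_forall fun x => ?_)
  rw [Real.norm_of_nonneg (by positivity)]
  exact profileDeriv_sq_le hp x

/-- The mass of the half-profile. -/
noncomputable def profileMass (p : ℝ) : ℝ := ∫ x in Ioi (0 : ℝ), profile p x ^ 2

/-- The Dirichlet energy of the half-profile. -/
noncomputable def profileDirichlet (p : ℝ) : ℝ := ∫ x in Ioi (0 : ℝ), profileDeriv p x ^ 2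

lemma profileMass_pos (hp : 2 < p) : 0 < profileMass p := by
  refine (setIntegral_pos_iff_support_of_nonneg_ae (Eventually.of_forall fun x => by positivity)
    (integrable_profile_sq hp).integrableOn).2 ?_
  have : Function.support (fun x => profile p x ^ 2) = univ :=
    Function.support_eq_univ fun x => (pow_pos (profile_pos p x) 2).ne'
  simp [this]

lemma tendsto_profile_mul_profileDeriv (hp : 2 < p) :
    Tendsto (fun x => profile p x * profileDeriv p x) atTop (𝓝 0) := by
  have h1 : Tendsto (fun x => Real.sqrt (2 / p) * (profile p x * profile p x)) atTop (𝓝 0) := by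
    simpa using ((tendsto_profile_atTop hp).mul (tendsto_profile_atTop hp)).const_mul
      (Real.sqrt (2 / p))
  refine squeeze_zero_norm (fun x => ?_) h1
  have h2 : |profileDeriv p x| ≤ Real.sqrt (2 / p) * profile p x := by
    rw [← abs_of_pos (profile_pos p x), ← Real.sqrt_sq_eq_abs, ← Real.sqrt_sq_eq_abs,
      ← Real.sqrt_mul (by positivity)]
    exact Real.sqrt_le_sqrt (profileDeriv_sq_le hp x)
  rw [norm_mul, Real.norm_of_nonneg (profile_pos p x).le, Real.norm_eq_abs]
  calc _ ≤ profile p x * (Real.sqrt (2 / p) * profile p x) := by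
        have := (profile_pos p x).le
        gcongr
    _ = _ := by ring

/-- The Pohozaev identity for the profile. -/
lemma profileMass_eq (hp : 2 < p) :
    (p - 2) / p * profileMass p = (p + 2) / 2 * profileDirichlet p := by
  -- (φφ')' = φ'² + φφ'', with φ'' and the power of φ eliminated by the soliton equation.
  -- Integrating over (0, ∞) leaves no boundary term, as φ'(0) = 0 and φφ' → 0.
  have hd : ∀ x, HasDerivAt (fun x => profile p x * profileDeriv p x)
      ((p + 2) / 2 * profileDeriv p x ^ 2 - (p - 2) / p * profile p x ^ 2) x := by
    intro x
    have hc := (Real.cosh_pos (profileRate p * x)).ne'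
    have h1 : HasDerivAt (fun x => profileRate p * x) (profileRate p) x := by
      simpa using (hasDerivAt_id x).const_mul (profileRate p)
    have h2 : HasDerivAt (profileDeriv p) _ x := (((h1.sinh.div h1.cosh hc).const_mul (Real.sqrt (2 / p))).mul
      (hasDerivAt_profile hp x)).neg
    have h3 := (hasDerivAt_profile hp x).mul h2
    refine HasDerivAt.congr_deriv (f := fun x => profile p x * profileDeriv p x) h3 ?_
    change _ * profileDeriv p x + _ * -(_ * profile p x + Real.sqrt (2 / p) *
      (Real.sinh (profileRate p * x) / Real.cosh (profileRate p * x)) * profileDeriv p x) = _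
    have hs : Real.sqrt (2 / p) * Real.sqrt (2 / p) = 2 / p := Real.mul_self_sqrt (by positivity)
    have hcs := Real.cosh_sq (profileRate p * x)
    rw [show profileDeriv p x = -(Real.sqrt (2 / p) * (Real.sinh (profileRate p * x) /
      Real.cosh (profileRate p * x)) * profile p x) from rfl]
    generalize profile p x = q
    generalize hS : Real.sinh (profileRate p * x) = S at *
    generalize hC : Real.cosh (profileRate p * x) = C at *
    rw [profileRate]
    generalize Real.sqrt (2 / p) = s at *
    have hp0 : p ≠ 0 := by linarith
    have e1 : (p - 2) / p = s * s * (p - 2) / 2 := by rw [hs]; field_simp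
    rw [e1]
    field_simp
    rw [hcs]
    ring
  have h := integral_Ioi_of_hasDerivAt_of_tendsto' (a := 0) (fun x _ => hd x)
    (((integrable_profileDeriv_sq hp).const_mul _).sub
      ((integrable_profile_sq hp).const_mul _)).integrableOn
    (tendsto_profile_mul_profileDeriv hp)
  rw [integral_sub ((integrable_profileDeriv_sq hp).const_mul _).integrableOn
    ((integrable_profile_sq hp).const_mul _).integrableOn, integral_const_mul, integral_const_mul,
    profileDeriv_zero] at h
  rw [profileMass, profileDirichlet]
  linarith

/-! ### Solitons of arbitrary height -/

/-- The soliton of height `N`. -/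
noncomputable def bump (p N x : ℝ) : ℝ := N * profile p (N ^ ((p - 2) / 2) * x)

/-- The derivative of the soliton of height `N`. -/
noncomputable def bumpDeriv (p N x : ℝ) : ℝ :=
  N * N ^ ((p - 2) / 2) * profileDeriv p (N ^ ((p - 2) / 2) * x)

variable {N : ℝ}

lemma bump_pos (hN : 0 < N) (x : ℝ) : 0 < bump p N x := mul_pos hN (profile_pos _ _)

lemma bump_neg (x : ℝ) : bump p N (-x) = bump p N x := by
  rw [bump, mul_neg, profile_neg, bump]

lemma bumpDeriv_neg (x : ℝ) : bumpDeriv p N (-x) = -bumpDeriv p N x := by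
  rw [bumpDeriv, mul_neg, profileDeriv_neg, bumpDeriv, mul_neg]

lemma bump_zero : bump p N 0 = N := by rw [bump, mul_zero, profile_zero, mul_one]

lemma hasDerivAt_bump (hp : 2 < p) (x : ℝ) : HasDerivAt (bump p N) (bumpDeriv p N x) x := by
  have h1 : HasDerivAt (fun x => N ^ ((p - 2) / 2) * x) (N ^ ((p - 2) / 2)) x := by
    simpa using (hasDerivAt_id x).const_mul (N ^ ((p - 2) / 2))
  have h2 := ((hasDerivAt_profile hp _).comp x h1).const_mul N
  refine HasDerivAt.congr_deriv (f := bump p N) h2 ?_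
  rw [bumpDeriv]; ring

lemma continuous_bump (hp : 2 < p) : Continuous (bump p N) :=
  continuous_iff_continuousAt.2 fun x => (hasDerivAt_bump hp x).continuousAt

lemma continuous_bumpDeriv (hp : 2 < p) : Continuous (bumpDeriv p N) :=
  continuous_const.mul ((continuous_profileDeriv hp).comp (by fun_prop))

lemma integrable_bump_sq (hp : 2 < p) (hN : 0 < N) : Integrable fun x => bump p N x ^ 2 := by
  simp only [bump, mul_pow]
  exact ((integrable_profile_sq hp).comp_mul_left' (Real.rpow_pos_of_pos hN _).ne').const_mul _

lemma integrable_bumpDeriv_sq (hp : 2 < p) (hN : 0 < N) :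
    Integrable fun x => bumpDeriv p N x ^ 2 := by
  simp only [bumpDeriv, mul_pow]
  exact ((integrable_profileDeriv_sq hp).comp_mul_left' (Real.rpow_pos_of_pos hN _).ne').const_mul _

lemma rpow_half_sq (hN : 0 < N) : (N ^ ((p - 2) / 2)) ^ 2 = N ^ (p - 2) := by
  rw [← Real.rpow_natCast, ← Real.rpow_mul hN.le]
  congr 1
  push_cast
  ring

lemma bump_rpow (hN : 0 < N) (x : ℝ) :
    bump p N x ^ p = N ^ (p - 2) * N ^ 2 * profile p (N ^ ((p - 2) / 2) * x) ^ p := by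
  rw [bump, Real.mul_rpow hN.le (profile_pos _ _).le, ← Real.rpow_natCast,
    ← Real.rpow_add hN]
  congr 2
  push_cast
  ring

/-- The exponent (p - 2)/2 in `bump` is the scaling for which |u'| = `slope p N u`, the equality
case of the calibration. -/
lemma bumpDeriv_sq (hp : 2 < p) (hN : 0 < N) (x : ℝ) :
    bumpDeriv p N x ^ 2 = 2 / p * (N ^ (p - 2) * bump p N x ^ 2 - bump p N x ^ p) := by
  rw [bump_rpow hN, bumpDeriv, mul_pow, mul_pow, profileDeriv_sq hp, rpow_half_sq hN, bump]
  ring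

lemma integral_bump_sq (hN : 0 < N) :
    ∫ x in Ioi (0 : ℝ), bump p N x ^ 2 = N ^ ((6 - p) / 2) * profileMass p := by
  simp only [bump, mul_pow]
  rw [integral_const_mul, integral_comp_mul_left_Ioi (fun x => profile p x ^ 2) 0
    (Real.rpow_pos_of_pos hN _), mul_zero, smul_eq_mul, ← mul_assoc, profileMass,
    ← Real.rpow_neg hN.le, ← Real.rpow_natCast, ← Real.rpow_add hN]
  congr 2
  push_cast
  ring

lemma integral_bumpDeriv_sq (hN : 0 < N) :
    ∫ x in Ioi (0 : ℝ), bumpDeriv p N x ^ 2 = N ^ ((p + 2) / 2) * profileDirichlet p := by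
  simp only [bumpDeriv, mul_pow]
  have h0 := Real.rpow_pos_of_pos hN ((p - 2) / 2)
  rw [integral_const_mul, integral_comp_mul_left_Ioi (fun x => profileDeriv p x ^ 2) 0 h0, mul_zero,
    smul_eq_mul, ← mul_assoc, profileDirichlet]
  congr 1
  have : N ^ ((p + 2) / 2) = N ^ 2 * N ^ ((p - 2) / 2) := by
    rw [← Real.rpow_natCast, ← Real.rpow_add hN]
    congr 1
    push_cast
    ring
  rw [this]
  field_simp

/-- The calibration evaluated at the height `N` is the Dirichlet energy of the half-soliton. -/
lemma calib_self (hp : 2 < p) (hN : 0 < N) :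
    calib p N N = N ^ ((p + 2) / 2) * profileDirichlet p := by
  -- For x > 0 the soliton decreases, so u' = -slope(u) and the derivative of calib(u) is slope(u)
  -- u' = -u'².
  have hd : ∀ x ∈ Ioi (0 : ℝ), HasDerivAt (fun x => calib p N (bump p N x))
      (-bumpDeriv p N x ^ 2) x := by
    intro x hx
    have h1 := (hasDerivAt_calib (N := N) hp (bump p N x)).comp x (hasDerivAt_bump hp x)
    refine HasDerivAt.congr_deriv (f := fun x => calib p N (bump p N x)) h1 ?_
    have h2 : slope p N (bump p N x) = -bumpDeriv p N x := by
      rw [slope, abs_of_pos (bump_pos hN x), ← bumpDeriv_sq hp hN, Real.sqrt_sq_eq_abs,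
        abs_of_nonpos]
      have : 0 ≤ Real.sinh (profileRate p * (N ^ ((p - 2) / 2) * x)) :=
        Real.sinh_nonneg_iff.2 (mul_nonneg (profileRate_pos hp).le
          (mul_nonneg (by positivity) (le_of_lt hx)))
      rw [bumpDeriv, profileDeriv, mul_neg, neg_nonpos]
      have := (profile_pos p (N ^ ((p - 2) / 2) * x)).le
      have := (Real.cosh_pos (profileRate p * (N ^ ((p - 2) / 2) * x))).le
      positivity
    rw [h2]
    ring
  have hlim : Tendsto (fun x => calib p N (bump p N x)) atTop (𝓝 0) := by
    have h1 : Tendsto (bump p N) atTop (𝓝 0) := by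
      have h2 := ((tendsto_profile_atTop hp).comp
        (tendsto_id.const_mul_atTop (Real.rpow_pos_of_pos hN ((p - 2) / 2)))).const_mul N
      rw [mul_zero] at h2
      exact h2
    have h3 := ((continuous_calib (N := N) hp).tendsto 0).comp h1
    rw [calib_zero] at h3
    exact h3
  have h := integral_Ioi_of_hasDerivAt_of_tendsto (a := 0)
    ((continuous_calib hp).comp (continuous_bump hp)).continuousWithinAt hd
    (integrable_bumpDeriv_sq hp hN).neg.integrableOn hlim
  simp only [integral_neg, Function.comp, bump_zero, integral_bumpDeriv_sq hN] at h
  linarith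

end NLS

namespace NLS

variable {p N μ : ℝ}

/-! ### Energy of explicit functions -/

lemma memLp_two_of_integrable_sq {f : ℝ → ℝ} (hf : Continuous f) {S : Set ℝ}
    (h : IntegrableOn (fun x => f x ^ 2) S) : MemLp f 2 (volume.restrict S) :=
  (memLp_two_iff_integrable_sq hf.aestronglyMeasurable).2 h

lemma energy_eq_of_hasDerivAt {S : Set ℝ} (hS : S.OrdConnected) {u u' : ℝ → ℝ}
    (hu : ∀ x, HasDerivAt u (u' x) x) (hu' : Continuous u')
    (hL : MemLp u 2 (volume.restrict S)) (hL' : MemLp u' 2 (volume.restrict S)) :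
    energy p S u = 1 / 2 * (∫ x in S, |u' x| ^ 2) - 1 / p * ∫ x in S, |u x| ^ p := by
  rw [energy]
  congr 2
  refine integral_congr_ae ?_
  filter_upwards [weakDeriv_ae_eq_of_hasDerivAt hS hu hu' hL hL'] with x hx
  rw [hx]

section

variable {S : Set ℝ} {c : ℝ}

lemma memLp_bump (hp : 2 < p) (hN : 0 < N) : MemLp (bump p N) 2 (volume.restrict S) :=
  memLp_two_of_integrable_sq (continuous_bump hp) (integrable_bump_sq hp hN).integrableOn

lemma memLp_bumpDeriv (hp : 2 < p) (hN : 0 < N) : MemLp (bumpDeriv p N) 2 (volume.restrict S) :=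
  memLp_two_of_integrable_sq (continuous_bumpDeriv hp) (integrable_bumpDeriv_sq hp hN).integrableOn

/-- The set enters only through the factor c for even integrands, so one computation serves the
half-line (c = 1) and the line (c = 2). -/
lemma bump_mem_H1Mass (hp : 2 < p) (hN : 0 < N)
    (hc : ∀ f : ℝ → ℝ, (∀ x, f (-x) = f x) → ∫ x in S, f x = c * ∫ x in Ioi 0, f x) :
    bump p N ∈ H1Mass S (c * (N ^ ((6 - p) / 2) * profileMass p)) := by
  refine ⟨mem_H1_of_hasDerivAt (hasDerivAt_bump hp) (continuous_bumpDeriv hp) (memLp_bump hp hN)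
    (memLp_bumpDeriv hp hN), ?_⟩
  simp only [sq_abs]
  rw [hc _ fun x => by rw [bump_neg], integral_bump_sq hN]

lemma energy_bump (hp : 2 < p) (hN : 0 < N) (hS : S.OrdConnected)
    (hc : ∀ f : ℝ → ℝ, (∀ x, f (-x) = f x) → ∫ x in S, f x = c * ∫ x in Ioi 0, f x) :
    energy p S (bump p N) =
      c * (N ^ ((p + 2) / 2) * (profileDirichlet p - profileMass p / p)) := by
  rw [energy_eq_of_hasDerivAt hS (hasDerivAt_bump hp) (continuous_bumpDeriv hp) (memLp_bump hp hN)
    (memLp_bumpDeriv hp hN), hc _ fun x => by rw [bumpDeriv_neg, abs_neg],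
    hc _ fun x => by rw [bump_neg]]
  -- Conservation of energy removes the power p: only the mass and the Dirichlet integral remain.
  have hrp : ∀ x, |bump p N x| ^ p =
      N ^ (p - 2) * bump p N x ^ 2 - p / 2 * bumpDeriv p N x ^ 2 := by
    intro x
    rw [bumpDeriv_sq hp hN, abs_of_pos (bump_pos hN x)]
    have : p ≠ 0 := by linarith
    field_simp
    ring
  simp only [hrp, sq_abs]
  rw [integral_sub ((integrable_bump_sq hp hN).const_mul _).integrableOn
    ((integrable_bumpDeriv_sq hp hN).const_mul _).integrableOn, integral_const_mul,
    integral_const_mul, integral_bump_sq hN, integral_bumpDeriv_sq hN]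
  have h1 : N ^ (p - 2) * (N ^ ((6 - p) / 2) * profileMass p) =
      N ^ ((p + 2) / 2) * profileMass p := by
    rw [← mul_assoc, ← Real.rpow_add hN]
    congr 2
    ring
  rw [h1]
  have : p ≠ 0 := by linarith
  field_simp
  ring

end

lemma setIntegral_Ici_eq (f : ℝ → ℝ) : ∫ x in Ici 0, f x = 1 * ∫ x in Ioi 0, f x := by
  rw [one_mul, integral_Ici_eq_integral_Ioi]

lemma setIntegral_univ_eq_of_even (f : ℝ → ℝ) (hf : ∀ x, f (-x) = f x) :
    ∫ x in univ, f x = 2 * ∫ x in Ioi 0, f x := by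
  rw [setIntegral_univ, ← integral_comp_abs]
  congr 1
  ext x
  rcases abs_choice x with h | h <;> rw [h]
  exact (hf x).symm

/-! ### The minimal energies on the line and on the half-line -/

/-- The height of the half-soliton of mass `μ`. -/
noncomputable def height (p μ : ℝ) : ℝ := (μ / profileMass p) ^ (2 / (6 - p))

/-- The energy of the half-soliton of mass `μ`. -/
noncomputable def halfEnergy (p μ : ℝ) : ℝ :=
  height p μ ^ ((p + 2) / 2) * (profileDirichlet p - profileMass p / p)

lemma height_pos (hp : 2 < p) (hμ : 0 < μ) : 0 < height p μ :=
  Real.rpow_pos_of_pos (div_pos hμ (profileMass_pos hp)) _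

/-- The half-soliton of height N has mass proportional to N^((6-p)/2), an exponent that can be
inverted because p ≠ 6. -/
lemma height_rpow (hp : 2 < p) (hp6 : p < 6) (hμ : 0 < μ) :
    height p μ ^ ((6 - p) / 2) * profileMass p = μ := by
  have h6 : 6 - p ≠ 0 := by linarith
  rw [height, ← Real.rpow_mul (div_pos hμ (profileMass_pos hp)).le,
    show 2 / (6 - p) * ((6 - p) / 2) = 1 by field_simp, Real.rpow_one,
    div_mul_cancel₀ _ (profileMass_pos hp).ne']

/-- Put N = Mr with M the height of the half-soliton, q = (p+2)/(2(p-2)), and D the Dirichlet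
integral of the half-profile. By Pohozaev, after division by M^((p+2)/2), the right side is D (t^q -
qt) with t = r^(p-2), and the left side is its value at t = 1. Bernoulli's inequality compares them;
its condition q ≥ 1 amounts to p ≤ 6. -/
lemma halfEnergy_le (hp : 2 < p) (hp6 : p < 6) (hμ : 0 < μ) (hN : 0 ≤ N) :
    halfEnergy p μ ≤ calib p N N - N ^ (p - 2) / p * μ := by
  set M := height p μ with hM
  have hM0 : 0 < M := height_pos hp hμ
  have hp0 : p ≠ 0 := by linarith
  have hp2 : 0 < p - 2 := by linarith
  have hB : 0 ≤ profileDirichlet p := integral_nonneg fun x => by positivity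
  set r := N / M with hr
  have hr0 : 0 ≤ r := div_nonneg hN hM0.le
  have hNr : N = M * r := by rw [hr]; field_simp
  have hcal : calib p N N = N ^ ((p + 2) / 2) * profileDirichlet p := by
    rcases hN.eq_or_lt with h | h
    · rw [← h, calib_zero, Real.zero_rpow (by linarith), zero_mul]
    · exact calib_self hp h
  have hbern := one_add_mul_self_le_rpow_one_add (s := r ^ (p - 2) - 1)
    (by linarith [Real.rpow_nonneg hr0 (p - 2)]) (p := (p + 2) / 2 / (p - 2))
    (by rw [le_div_iff₀ hp2]; linarith)
  rw [add_sub_cancel, ← Real.rpow_mul hr0,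
    show (p - 2) * ((p + 2) / 2 / (p - 2)) = (p + 2) / 2 by field_simp] at hbern
  have hA : profileMass p / p = profileDirichlet p * ((p + 2) / 2 / (p - 2)) := by
    have := profileMass_eq hp
    field_simp at this ⊢
    linarith
  have hμ' : M ^ (p - 2) * μ = M ^ ((p + 2) / 2) * profileMass p := by
    conv_lhs => rw [← height_rpow hp hp6 hμ]
    rw [← hM, ← mul_assoc, ← Real.rpow_add hM0]
    congr 2
    ring
  have hkey : profileDirichlet p - profileMass p / p ≤
      r ^ ((p + 2) / 2) * profileDirichlet p - r ^ (p - 2) * (profileMass p / p) := by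
    rw [hA]
    nlinarith [mul_le_mul_of_nonneg_left hbern hB]
  rw [hcal, halfEnergy, ← hM, hNr, Real.mul_rpow hM0.le hr0, Real.mul_rpow hM0.le hr0]
  calc M ^ ((p + 2) / 2) * (profileDirichlet p - profileMass p / p)
      ≤ M ^ ((p + 2) / 2) * (r ^ ((p + 2) / 2) * profileDirichlet p -
        r ^ (p - 2) * (profileMass p / p)) :=
        mul_le_mul_of_nonneg_left hkey (Real.rpow_nonneg hM0.le _)
    _ = M ^ ((p + 2) / 2) * r ^ ((p + 2) / 2) * profileDirichlet p -
        r ^ (p - 2) / p * (M ^ ((p + 2) / 2) * profileMass p) := by ring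
    _ = _ := by rw [← hμ']; ring

theorem isLeast_energy_Ici (hp : 2 < p) (hp6 : p < 6) (hμ : 0 < μ) :
    IsLeast (energy p (Ici 0) '' H1Mass (Ici 0) μ) (halfEnergy p μ) := by
  have hM := height_pos hp hμ
  refine ⟨⟨bump p (height p μ), ?_, ?_⟩, ?_⟩
  · have := bump_mem_H1Mass hp hM (S := Ici 0) fun f _ => setIntegral_Ici_eq f
    rwa [one_mul, height_rpow hp hp6 hμ] at this
  · rw [energy_bump hp hM ordConnected_Ici fun f _ => setIntegral_Ici_eq f, one_mul, halfEnergy]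
  · rintro _ ⟨u, hu, rfl⟩
    obtain ⟨N, hN, h⟩ := exists_calib_le_energy_Ici hp hu
    exact (halfEnergy_le hp hp6 hμ hN).trans h

lemma bump_mem_H1Mass_univ (hp : 2 < p) (hp6 : p < 6) (hμ : 0 < μ) :
    bump p (height p (μ / 2)) ∈ H1Mass univ μ := by
  have hμ2 : 0 < μ / 2 := by linarith
  have := bump_mem_H1Mass hp (height_pos hp hμ2) setIntegral_univ_eq_of_even
  rwa [height_rpow hp hp6 hμ2, mul_div_cancel₀ _ (two_ne_zero' ℝ)] at this

lemma energy_bump_univ (hp : 2 < p) (hμ : 0 < μ) :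
    energy p univ (bump p (height p (μ / 2))) = 2 * halfEnergy p (μ / 2) := by
  rw [energy_bump hp (height_pos hp (by linarith)) ordConnected_univ setIntegral_univ_eq_of_even,
    halfEnergy]

/-- The calibration bound on the line is twice the half-line expression at mass μ/2. -/
theorem le_energy_univ (hp : 2 < p) (hp6 : p < 6) (hμ : 0 < μ) {u : ℝ → ℝ}
    (hu : u ∈ H1Mass univ μ) : 2 * halfEnergy p (μ / 2) ≤ energy p univ u := by
  obtain ⟨N, hN, h⟩ := exists_calib_le_energy_univ hp hu
  have := halfEnergy_le hp hp6 (half_pos hμ) hN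
  linarith

theorem isSoliton_bump (hp : 2 < p) (hp6 : p < 6) (hμ : 0 < μ) :
    IsSoliton p μ (bump p (height p (μ / 2))) where
  mem := bump_mem_H1Mass_univ hp hp6 hμ
  isMinOn u hu := by
    change energy p univ (bump p (height p (μ / 2))) ≤ energy p univ u
    rw [energy_bump_univ hp hμ]
    exact le_energy_univ hp hp6 hμ hu
  pos := bump_pos (height_pos hp (half_pos hμ))
  even := bump_neg

/-- Uniqueness of the soliton is not needed: any two minimizers have equal energy. -/
theorem IsSoliton.energy_eq (hp : 2 < p) (hp6 : p < 6) (hμ : 0 < μ) {φ : ℝ → ℝ}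
    (hφ : IsSoliton p μ φ) : energy p univ φ = 2 * halfEnergy p (μ / 2) := by
  refine le_antisymm ?_ (le_energy_univ hp hp6 hμ hφ.mem)
  rw [← energy_bump_univ hp hμ]
  exact hφ.isMinOn (bump_mem_H1Mass_univ hp hp6 hμ)

/-! ### Escaping along a half-line -/

/-- After the shift x = y + n the second argument exp(-(y + n)) tends to 0 and the domain [-n, ∞)
exhausts ℝ, so dominated convergence applies. Keeping g general covers the mass, the L^p term and
the Dirichlet term at once. -/
lemma tendsto_integral_escape {g : ℝ → ℝ → ℝ} (hg : Continuous (Function.uncurry g))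
    {b : ℝ → ℝ} (hb : Integrable b) (hgb : ∀ y, ∀ s ∈ Icc (0 : ℝ) 1, |g y s| ≤ b y) :
    Tendsto (fun n : ℕ => ∫ x in Ici 0, g (x - n) (Real.exp (-x))) atTop
      (𝓝 (∫ y, g y 0)) := by
  have hshift : ∀ n : ℕ, ∫ x in Ici 0, g (x - n) (Real.exp (-x)) =
      ∫ y, (Ici (-(n : ℝ))).indicator (fun y => g y (Real.exp (-(y + n)))) y := by
    intro n
    rw [← integral_indicator measurableSet_Ici, ← integral_add_right_eq_self _ (n : ℝ)]
    congr 1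
    ext y
    by_cases h : 0 ≤ y + n
    · rw [indicator_of_mem (mem_Ici.2 h), indicator_of_mem (mem_Ici.2 (by linarith)),
        add_sub_cancel_right]
    · rw [indicator_of_notMem (by simpa using h),
        indicator_of_notMem (by rw [mem_Ici]; intro h'; exact h (by linarith))]
  simp_rw [hshift]
  refine tendsto_integral_of_dominated_convergence b (fun n => ?_) hb (fun n => ?_) ?_
  · refine (Continuous.aestronglyMeasurable ?_).indicator measurableSet_Ici
    exact hg.comp (f := fun y => (y, Real.exp (-(y + n)))) (by fun_prop)
  · filter_upwards with y
    by_cases h : y ∈ Ici (-(n : ℝ))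
    · rw [indicator_of_mem h, Real.norm_eq_abs]
      refine hgb y _ ⟨(Real.exp_pos _).le, Real.exp_le_one_iff.2 ?_⟩
      rw [mem_Ici] at h
      linarith
    · rw [indicator_of_notMem h, norm_zero]
      exact (abs_nonneg _).trans (hgb y 0 (by simp))
  · filter_upwards with y
    have h1 : Tendsto (fun n : ℕ => g y (Real.exp (-(y + n)))) atTop (𝓝 (g y 0)) := by
      have h2 : Tendsto (fun n : ℕ => Real.exp (-(y + n))) atTop (𝓝 0) :=
        Real.tendsto_exp_neg_atTop_nhds_zero.comp
          (tendsto_atTop_add_const_left _ y tendsto_natCast_atTop_atTop)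
      have h3 : Continuous (g y) := hg.comp (f := fun s => (y, s)) (by fun_prop)
      exact (h3.tendsto 0).comp h2
    refine h1.congr' ?_
    filter_upwards [(tendsto_natCast_atTop_atTop (R := ℝ)).eventually_ge_atTop (-y)] with n hn
    rw [indicator_of_mem (by rw [mem_Ici]; linarith)]

end NLS

namespace MetricGraph

open NLS

variable {V E : Type*} [Fintype E] {G : MetricGraph V E}

/-- A function on the half-line vanishing at the origin extends by zero to the graph. -/
lemma extend_mem_H1Mass [DecidableEq E] {e₀ : E} (he₀ : G.IsHalfLine e₀) {μ : ℝ} {w : ℝ → ℝ}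
    (hw : w ∈ NLS.H1Mass (Ici 0) μ) (hw0 : w 0 = 0) : Pi.single e₀ w ∈ G.H1Mass μ := by
  have hI := interval_of_isHalfLine he₀
  have hend : ∀ v e x, G.EndAt v e x → (Pi.single e₀ w : E → ℝ → ℝ) e x = 0 := by
    intro v e x h
    by_cases he : e = e₀
    · subst he
      rcases h with ⟨rfl, _⟩ | ⟨h, _⟩
      · rw [Pi.single_eq_same, hw0]
      · exact absurd he₀ h
    · rw [Pi.single_eq_of_ne he]; rfl
  have hH1 : ∀ e, (Pi.single e₀ w : E → ℝ → ℝ) e ∈ NLS.H1 (G.interval e) := by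
    intro e
    by_cases he : e = e₀
    · subst he
      rw [Pi.single_eq_same, hI]
      exact hw.1
    · rw [Pi.single_eq_of_ne he]
      exact mem_H1_of_hasDerivAt (u' := 0) (fun x => hasDerivAt_const x 0) continuous_zero
        MemLp.zero MemLp.zero
  refine ⟨⟨⟨fun e => (hH1 e).1, fun v e f x y hx hy => ?_⟩, hH1⟩, ?_⟩
  · rw [hend v e x hx, hend v f y hy]
  · rw [Finset.sum_eq_single_of_mem e₀ (Finset.mem_univ _)]
    · rw [Pi.single_eq_same, hI]
      exact hw.2
    · intro e _ he
      rw [Pi.single_eq_of_ne he]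
      simp

lemma energy_extend [DecidableEq E] {e₀ : E} (he₀ : G.IsHalfLine e₀) {p : ℝ} (hp : 2 < p)
    (w : ℝ → ℝ) : G.energy p (Pi.single e₀ w) = NLS.energy p (Ici 0) w := by
  have hI := interval_of_isHalfLine he₀
  rw [energy, NLS.energy, Finset.sum_eq_single_of_mem e₀ (Finset.mem_univ _),
    Finset.sum_eq_single_of_mem e₀ (Finset.mem_univ _), Pi.single_eq_same, hI]
  · intro e _ he
    rw [Pi.single_eq_of_ne he]
    simp [Real.zero_rpow (show p ≠ 0 by linarith)]
  · intro e _ he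
    rw [Pi.single_eq_of_ne he]
    -- Even for the zero function the chosen weak derivative is known to vanish only almost
    -- everywhere.
    have h := weakDeriv_ae_eq_of_hasDerivAt (u := 0) (u' := 0) (ordConnected_interval (G := G) e)
      (fun x => hasDerivAt_const x 0) continuous_zero MemLp.zero MemLp.zero
    rw [integral_congr_ae (g := fun _ => 0), integral_zero]
    filter_upwards [h] with x hx
    simp [hx]

/-- Functions on a graph with a half-line approximate the energy of any regular function on `ℝ`. -/
theorem exists_tendsto_energy {e₀ : E} (he₀ : G.IsHalfLine e₀) {p μ : ℝ} (hp : 2 < p) (hμ : 0 < μ)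
    {φ φ' : ℝ → ℝ} (hφ : ∀ x, HasDerivAt φ (φ' x) x) (hφ' : Continuous φ')
    (hL : MemLp φ 2 (volume.restrict univ)) (hL' : MemLp φ' 2 (volume.restrict univ))
    (hmass : ∫ x, |φ x| ^ 2 = μ) :
    ∃ U : ℕ → E → ℝ → ℝ, (∀ᶠ n in atTop, U n ∈ G.H1Mass μ) ∧
      Tendsto (fun n => G.energy p (U n)) atTop (𝓝 (NLS.energy p univ φ)) := by
  classical
  have hφc : Continuous φ := continuous_iff_continuousAt.2 fun x => (hφ x).continuousAt
  have hφH : φ ∈ NLS.H1 univ := mem_H1_of_hasDerivAt hφ hφ' hL hL'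
  have iφ : Integrable fun x => |φ x| ^ 2 := integrableOn_univ.1 (integrable_abs_sq hφH)
  have iφ' : Integrable fun x => |φ' x| ^ 2 := integrableOn_univ.1 (integrableOn_abs_sq hL')
  have iφp : Integrable fun x => |φ x| ^ p :=
    integrableOn_univ.1 (integrable_abs_rpow hp ordConnected_univ hφH)
  -- The factor 1 - exp(-x) vanishes at the origin, as extension by zero requires, and tends to 1
  -- where the shifted function concentrates.
  set w : ℕ → ℝ → ℝ := fun n x => φ (x - n) * (1 - Real.exp (-x)) with hw
  set w' : ℕ → ℝ → ℝ := fun n x =>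
    φ' (x - n) * (1 - Real.exp (-x)) + φ (x - n) * Real.exp (-x) with hw'
  have hwd : ∀ n x, HasDerivAt (w n) (w' n x) x := by
    intro n x
    have h1 : HasDerivAt (fun x : ℝ => φ (x - n)) (φ' (x - n)) x :=
      (hφ (x - n)).comp_sub_const x n
    have h2 : HasDerivAt (fun x : ℝ => 1 - Real.exp (-x)) (Real.exp (-x)) x := by
      simpa using ((hasDerivAt_neg x).exp).const_sub 1
    exact h1.mul h2
  have hwc' : ∀ n, Continuous (w' n) := fun n => by
    simp only [hw']
    fun_prop
  have hwc : ∀ n, Continuous (w n) := fun n => by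
    simp only [hw]
    fun_prop
  have hle : ∀ y : ℝ, ∀ s ∈ Icc (0 : ℝ) 1, |φ y * (1 - s)| ≤ |φ y| := by
    rintro y s ⟨hs0, hs1⟩
    rw [abs_mul]
    exact mul_le_of_le_one_right (abs_nonneg _) (abs_le.2 ⟨by linarith, by linarith⟩)
  have hle' : ∀ y : ℝ, ∀ s ∈ Icc (0 : ℝ) 1,
      |φ' y * (1 - s) + φ y * s| ^ 2 ≤ |φ' y| ^ 2 + |φ y| ^ 2 := by
    rintro y s ⟨hs0, hs1⟩
    simp only [sq_abs]
    nlinarith [mul_nonneg (mul_nonneg hs0 (sub_nonneg.2 hs1)) (sq_nonneg (φ' y - φ y)),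
      mul_nonneg hs0 (sq_nonneg (φ' y)), mul_nonneg (sub_nonneg.2 hs1) (sq_nonneg (φ y))]
  have hexp : ∀ x ∈ Ici (0 : ℝ), Real.exp (-x) ∈ Icc (0 : ℝ) 1 := fun x hx =>
    ⟨(Real.exp_pos _).le, Real.exp_le_one_iff.2 (neg_nonpos.2 hx)⟩
  have hwL : ∀ n, MemLp (w n) 2 (volume.restrict (Ici 0)) := by
    intro n
    refine memLp_two_of_integrable_sq (hwc n) (Integrable.mono'
      (iφ.comp_sub_right (n : ℝ)).integrableOn ((hwc n).pow 2).aestronglyMeasurable ?_)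
    filter_upwards [ae_restrict_mem measurableSet_Ici] with x hx
    rw [Real.norm_of_nonneg (sq_nonneg _), ← sq_abs]
    exact pow_le_pow_left₀ (abs_nonneg _) (hle _ _ (hexp x hx)) 2
  have hwL' : ∀ n, MemLp (w' n) 2 (volume.restrict (Ici 0)) := by
    intro n
    refine memLp_two_of_integrable_sq (hwc' n) (Integrable.mono'
      ((iφ'.add iφ).comp_sub_right (n : ℝ)).integrableOn ((hwc' n).pow 2).aestronglyMeasurable ?_)
    filter_upwards [ae_restrict_mem measurableSet_Ici] with x hx
    rw [Real.norm_of_nonneg (sq_nonneg _), ← sq_abs]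
    exact hle' _ _ (hexp x hx)
  have hlim2 : Tendsto (fun n => ∫ x in Ici 0, |w n x| ^ 2) atTop (𝓝 μ) := by
    have := tendsto_integral_escape (g := fun y s => |φ y * (1 - s)| ^ 2) (by fun_prop) iφ
      fun y s hs => by
        rw [abs_of_nonneg (by positivity)]
        exact pow_le_pow_left₀ (abs_nonneg _) (hle y s hs) 2
    simpa only [sub_zero, mul_one, hmass] using this
  have hlimp : Tendsto (fun n => ∫ x in Ici 0, |w n x| ^ p) atTop (𝓝 (∫ x, |φ x| ^ p)) := by
    have hcp : Continuous fun t : ℝ => |t| ^ p :=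
      continuous_abs.rpow_const fun _ => Or.inr (by linarith)
    have := tendsto_integral_escape (g := fun y s => |φ y * (1 - s)| ^ p)
      (hcp.comp (f := fun z : ℝ × ℝ => φ z.1 * (1 - z.2)) (by fun_prop)) iφp
      fun y s hs => by
        rw [abs_of_nonneg (by positivity)]
        exact Real.rpow_le_rpow (abs_nonneg _) (hle y s hs) (by linarith)
    simpa only [sub_zero, mul_one] using this
  have hlim' : Tendsto (fun n => ∫ x in Ici 0, |w' n x| ^ 2) atTop (𝓝 (∫ x, |φ' x| ^ 2)) := by
    have := tendsto_integral_escape (g := fun y s => |φ' y * (1 - s) + φ y * s| ^ 2)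
      (by fun_prop) (iφ'.add iφ)
      fun y s hs => by
        rw [abs_of_nonneg (by positivity)]
        exact hle' y s hs
    simpa only [sub_zero, mul_one, mul_zero, add_zero] using this
  set m : ℕ → ℝ := fun n => ∫ x in Ici 0, |w n x| ^ 2 with hm
  -- The factor restoring the mass μ. Since m n → μ > 0, it is valid for large n and tends to 1.
  set c : ℕ → ℝ := fun n => Real.sqrt (μ / m n) with hc
  have hclim : Tendsto c atTop (𝓝 1) := by
    have h1 : Tendsto (fun n => μ / m n) atTop (𝓝 1) := by
      have := (tendsto_const_nhds (x := μ)).div hlim2 hμ.ne'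
      rwa [div_self hμ.ne'] at this
    have h2 := (Real.continuous_sqrt.tendsto 1).comp h1
    rwa [Real.sqrt_one] at h2
  have hcwd : ∀ n x, HasDerivAt (fun x => c n * w n x) (c n * w' n x) x := fun n x =>
    (hwd n x).const_mul (c n)
  have hcw : ∀ n, MemLp (fun x => c n * w n x) 2 (volume.restrict (Ici 0)) := fun n =>
    (hwL n).const_mul (c n)
  have hcw' : ∀ n, MemLp (fun x => c n * w' n x) 2 (volume.restrict (Ici 0)) := fun n =>
    (hwL' n).const_mul (c n)
  refine ⟨fun n => Pi.single e₀ fun x => c n * w n x, ?_, ?_⟩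
  · filter_upwards [hlim2.eventually (lt_mem_nhds hμ)] with n hn
    refine extend_mem_H1Mass he₀ ⟨mem_H1_of_hasDerivAt (hcwd n) (continuous_const.mul (hwc' n))
      (hcw n) (hcw' n), ?_⟩ (by simp [hw])
    have h1 : ∀ x, |c n * w n x| ^ 2 = μ / m n * |w n x| ^ 2 := fun x => by
      rw [abs_mul, mul_pow, sq_abs, Real.sq_sqrt (div_nonneg hμ.le hn.le)]
    simp only [h1]
    rw [integral_const_mul]
    exact div_mul_cancel₀ _ hn.ne'
  · have hE : ∀ n, G.energy p (Pi.single e₀ fun x => c n * w n x) =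
        1 / 2 * (c n ^ 2 * ∫ x in Ici 0, |w' n x| ^ 2) -
          1 / p * (c n ^ p * ∫ x in Ici 0, |w n x| ^ p) := by
      intro n
      have hc0 : 0 ≤ c n := Real.sqrt_nonneg _
      rw [energy_extend he₀ hp, energy_eq_of_hasDerivAt ordConnected_Ici (hcwd n)
        (continuous_const.mul (hwc' n)) (hcw n) (hcw' n)]
      simp only [abs_mul, abs_of_nonneg hc0, mul_pow, Real.mul_rpow hc0 (abs_nonneg _),
        integral_const_mul]
    simp only [hE]
    rw [energy_eq_of_hasDerivAt ordConnected_univ hφ hφ' hL hL', setIntegral_univ,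
      setIntegral_univ]
    have h2 : Tendsto (fun n => c n ^ 2) atTop (𝓝 1) := by simpa using hclim.pow 2
    have h3 : Tendsto (fun n => c n ^ p) atTop (𝓝 1) := by
      simpa using hclim.rpow_const (p := p) (Or.inl one_ne_zero)
    have h4 := ((h2.mul hlim').const_mul (1 / 2)).sub ((h3.mul hlimp).const_mul (1 / p))
    rwa [one_mul, one_mul] at h4

end MetricGraph

/-! ### The comparison theorem -/

theorem mainTheorem5 {V E : Type*} [Finite V] [Fintype E] (G : MetricGraph V E)
    (hconn : G.IsConnected) (hhalf : ∃ e, G.IsHalfLine e)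
    (p μ : ℝ) (hp₂ : 2 < p) (hp₆ : p < 6) (hμ : 0 < μ) :
    -- the solitons of mass `μ` and `2μ` exist
    (∃ φ, NLS.IsSoliton p μ φ) ∧ (∃ ψ, NLS.IsSoliton p (2 * μ) ψ) ∧
    -- the infimum on the graph is a genuine one
    IsGLB (G.energy p '' G.H1Mass μ) (G.infEnergy p μ) ∧
    ∀ φ ψ, NLS.IsSoliton p μ φ → NLS.IsSoliton p (2 * μ) ψ →
      -- upper bound
      (G.infEnergy p μ ≤ NLS.energy p Set.univ φ ∧
        IsLeast (NLS.energy p Set.univ '' NLS.H1Mass Set.univ μ) (NLS.energy p Set.univ φ)) ∧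
      -- lower bound
      (1 / 2 * NLS.energy p Set.univ ψ ≤ G.infEnergy p μ ∧
        IsLeast (NLS.energy p (Set.Ici 0) '' NLS.H1Mass (Set.Ici 0) μ)
          (1 / 2 * NLS.energy p Set.univ ψ)) := by
  obtain ⟨e₀, he₀⟩ := hhalf
  have hlower : ∀ E' ∈ G.energy p '' G.H1Mass μ, NLS.halfEnergy p μ ≤ E' := by
    rintro _ ⟨u, hu, rfl⟩
    obtain ⟨N, hN, h⟩ := G.exists_calib_le_energy hconn he₀ hp₂ hu
    exact (NLS.halfEnergy_le hp₂ hp₆ hμ hN).trans h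
  have hh := NLS.height_pos hp₂ (half_pos hμ)
  obtain ⟨U, hU, hUlim⟩ := G.exists_tendsto_energy he₀ hp₂ hμ (NLS.hasDerivAt_bump hp₂)
    (NLS.continuous_bumpDeriv hp₂) (NLS.memLp_bump hp₂ hh) (NLS.memLp_bumpDeriv hp₂ hh)
    (by simpa using (NLS.bump_mem_H1Mass_univ hp₂ hp₆ hμ).2)
  have hne : (G.energy p '' G.H1Mass μ).Nonempty := by
    obtain ⟨n, hn⟩ := hU.exists
    exact ⟨_, U n, hn, rfl⟩
  -- Nonemptiness and the lower bound rule out the default value 0 of `sInf` on ℝ.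
  have hglb : IsGLB (G.energy p '' G.H1Mass μ) (G.infEnergy p μ) :=
    Real.isGLB_sInf hne ⟨_, hlower⟩
  refine ⟨⟨_, NLS.isSoliton_bump hp₂ hp₆ hμ⟩, ⟨_, NLS.isSoliton_bump hp₂ hp₆ (by linarith)⟩, hglb,
    fun φ ψ hφ hψ => ⟨⟨?_, ⟨φ, hφ.mem, rfl⟩, ?_⟩, ?_⟩⟩
  · rw [hφ.energy_eq hp₂ hp₆ hμ, ← NLS.energy_bump_univ hp₂ hμ]
    refine ge_of_tendsto hUlim ?_
    filter_upwards [hU] with n hn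
    exact hglb.1 ⟨_, hn, rfl⟩
  · rintro _ ⟨u, hu, rfl⟩
    exact hφ.isMinOn hu
  -- A soliton of mass 2μ consists of two half-solitons of mass μ.
  · have h : 1 / 2 * NLS.energy p Set.univ ψ = NLS.halfEnergy p μ := by
      rw [hψ.energy_eq hp₂ hp₆ (by linarith), mul_div_cancel_left₀ _ (two_ne_zero' ℝ)]
      ring
    rw [h]
    exact ⟨hglb.2 hlower, NLS.isLeast_energy_Ici hp₂ hp₆ hμ⟩
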